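/- Fix a field $\mathbb F$ and $n\in\mathbb N$. A type of length $n$ is a sequence $\tau\in\{\to,\leftarrow\}^{n-1}$. A zigzag module of length $n$ and type $\tau$ (a $\tau$-module) is a sequence $V_1\leftrightarrow V_2\leftrightarrow\cdots\leftrightarrow V_n$ of finite-dimensional $\mathbb F$-vector spaces and linear maps $p_1,\dots,p_{n-1}$, the $i$-th map having the direction of the $i$-th entry of $\tau$. Isomorphisms and direct sums of $\tau$-modules are defined componentwise. For $1\le b\le d\le n$ the interval module $\mathbb I_\tau([b,d])$ has $\mathbb F$ at the positions $b,\dots,d$, $0$ elsewhere, identity maps inside $[b,d]$ and zero maps elsewhere; it is simple if $b=d$. Every $\tau$-module is isomorphic to a direct sum $\bigoplus_j\mathbb I_\tau([b_j,d_j])$ for a unique finite multiset of intervals, and its persistence diagram is the multiset $\mathrm{Dgm}(\mathbb V)=\{(b_j,d_j)\}_j$ of points of $\mathbb R^2$. Let $\mathcal S(\mathbb V)=\bigoplus_{(b,d)\in\mathrm{Dgm}(\mathbb V),\,b\ne d}\mathbb I_\tau([b,d])$. Write $\mathbb V\sim\mathbb W$ if $\mathbb W$ is isomorphic to a module obtained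 from $\mathbb V$ by finitely many (possibly zero) steps, each of which replaces a structure map that is an isomorphism by its inverse (reversing the corresponding arrow of the type). Write $\mathbb W\precsim\mathbb V$ if $\mathbb W\sim\mathbb W'$ for some $\mathbb W'$ of the same type as $\mathbb V$ such that $\mathbb V\cong\mathbb W'\oplus\mathbb U$ for some $\mathbb U$. For $1\le k\le n$, the reflection $\mathcal L_k$ (resp. $\mathcal C_k$) replaces $V_k$ and the arrows at $k$ by the limit of the diagram $V_{k-1}\leftrightarrow V_k\leftrightarrow V_{k+1}$ with its projections to $V_{k-1}$ and $V_{k+1}$ (resp. by its colimit with the canonical maps from $V_{k-1}$ and $V_{k+1}$); the new type has a source (resp. a sink) at $k$. For $k=1$ and $k=n$ the missing neighbour is a zero space, and each direction of the zero map between it and $V_k$ gives a reflection. For a finite sequence $\mathfrak R=(\mathcal R_\ell,\dots,\mathcal R_1)$ of reflections put $$\mathfrak R(\mathbb V)=(\mathcal S\circ\mathcal R_\ell\circ\mathcal S\circ\cdots\circ\mathcal S\circ\mathcal R_1\circ\mathcal S)(\mathbb V),\qquad C_1(\mathfrak R)=\ell,$$ the empty sequence acting as $\mathcal S$ and having cost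 $0$. The $1$-reflection distance of zigzag modules $\mathbb V,\mathbb W$ of length $n$ (of possibly different types) is $$d^1_{\mathcal R}(\mathbb V,\mathbb W)=\min\bigl\{\max\{C_1(\mathfrak R),C_1(\mathfrak R')\}\ :\ \mathfrak R(\mathbb V)\precsim\mathbb W\ \text{and}\ \mathfrak R'(\mathbb W)\precsim\mathbb V\bigr\}.$$ A matching $M$ between finite multisets $S,T$ of points of $\mathbb R^2$ is a bijection between a sub-multiset of $S$ and a sub-multiset of $T$. Its cost $c_1(M)$ is the maximum of the numbers $\|s-t\|_1$ over the matched pairs $(s,t)$ and of the numbers $|r_y-r_x|$ over the unmatched points $r=(r_x,r_y)$ of $S$ and $T$ (and $0$ if there are no points). The $\ell^1$-bottleneck distance is $d_b^1(S,T)=\inf_M c_1(M)$. Theorem. For all zigzag modules $\mathbb V,\mathbb W$ of length $n$, $$d_b^1(\mathrm{Dgm}(\mathbb V),\mathrm{Dgm}(\mathbb W))\le d_{\mathcal R}^1(\mathbb V,\mathbb W).$$ -/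

import Mathlib

open scoped ENNReal

universe u

/-- The direction of an arrow between two consecutive vector spaces, read from left to right. -/
inductive Dir : Type
  | right : Dir
  | left : Dir
  deriving DecidableEq

/-- The opposite direction. -/
def Dir.flip : Dir → Dir
  | Dir.right => Dir.left
  | Dir.left => Dir.right

/-- Types of zigzag modules of length `n`: sequences of `n - 1` arrows. Indices are counted from
`0` here, so the entry `l` is the arrow between the positions `l` and `l + 1`. -/
abbrev ZigzagType (n : ℕ) : Type := Fin (n - 1) → Dir

namespace ZigzagType

variable {n : ℕ}

/-- In a zigzag of type `τ`, the arrow number `l` starts at position `i` and ends at `j`. -/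
def ArrowAt (τ : ZigzagType n) (l : Fin (n - 1)) (i j : Fin n) : Prop :=
  (i.val = l.val ∧ j.val = l.val + 1 ∧ τ l = Dir.right) ∨
    (j.val = l.val ∧ i.val = l.val + 1 ∧ τ l = Dir.left)

/-- In a zigzag of type `τ` there is an arrow from position `i` to position `j`. -/
def Arrow (τ : ZigzagType n) (i j : Fin n) : Prop := ∃ l : Fin (n - 1), τ.ArrowAt l i j

/-- Reverse the arrow number `l`. -/
def reverse (l : Fin (n - 1)) (τ : ZigzagType n) : ZigzagType n :=
  Function.update τ l (τ l).flip

/-- Put a source at position `k`: arrows touching `k` point away from `k`. -/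
def putSource (k : Fin n) (τ : ZigzagType n) : ZigzagType n := fun l =>
  if l.val = k.val then Dir.right else if l.val + 1 = k.val then Dir.left else τ l

/-- Put a sink at position `k`: arrows touching `k` point towards `k`. -/
def putSink (k : Fin n) (τ : ZigzagType n) : ZigzagType n := fun l =>
  if l.val = k.val then Dir.left else if l.val + 1 = k.val then Dir.right else τ l

/-- `i` and `j` are the two ends of the arrow number `l`. -/
def Ends (l : Fin (n - 1)) (i j : Fin n) : Prop :=
  (i.val = l.val ∧ j.val = l.val + 1) ∨ (j.val = l.val ∧ i.val = l.val + 1)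

instance (l : Fin (n - 1)) (i j : Fin n) : Decidable (Ends l i j) :=
  inferInstanceAs (Decidable (_ ∨ _))

/-- The position `k` together with its neighbours `k - 1` and `k + 1`, if they exist. -/
abbrev Nbhd (k : Fin n) : Type := {j : Fin n // j.val ≤ k.val + 1 ∧ k.val ≤ j.val + 1}

/-- `k` as an element of its neighbourhood. -/
def Nbhd.center (k : Fin n) : Nbhd k := ⟨k, by omega, by omega⟩

theorem Arrow.ne {τ : ZigzagType n} {i j : Fin n} (h : τ.Arrow i j) : i ≠ j := by
  rintro rfl
  obtain ⟨l, h | h⟩ := h <;> omega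

theorem Arrow.target_mem {τ : ZigzagType n} {i j : Fin n} (h : τ.Arrow i j) :
    j.val ≤ i.val + 1 ∧ i.val ≤ j.val + 1 := by
  obtain ⟨l, h | h⟩ := h <;> omega

theorem Arrow.source_mem {τ : ZigzagType n} {i j : Fin n} (h : τ.Arrow i j) :
    i.val ≤ j.val + 1 ∧ j.val ≤ i.val + 1 := h.target_mem.symm

theorem Arrow.of_reverse_ends {τ : ZigzagType n} {l : Fin (n - 1)} {i j : Fin n}
    (h : (τ.reverse l).Arrow i j) (he : Ends l i j) : τ.ArrowAt l j i := by
  obtain ⟨m, hm⟩ := h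
  have hml : m = l := by
    apply Fin.ext
    rcases hm with hm | hm <;> rcases he with he | he <;> omega
  subst hml
  cases hd : τ m <;> simp [ArrowAt, reverse, hd, Dir.flip] at hm ⊢ <;> omega

theorem Arrow.of_reverse_not_ends {τ : ZigzagType n} {l : Fin (n - 1)} {i j : Fin n}
    (h : (τ.reverse l).Arrow i j) (he : ¬ Ends l i j) : τ.Arrow i j := by
  obtain ⟨m, hm⟩ := h
  have hml : m ≠ l := by
    rintro rfl
    apply he
    rcases hm with hm | hm
    · exact Or.inl ⟨hm.1, hm.2.1⟩
    · exact Or.inr ⟨hm.1, hm.2.1⟩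
  refine ⟨m, ?_⟩
  simpa [ArrowAt, reverse, Function.update_of_ne hml] using hm

theorem Arrow.target_ne_of_putSource {τ : ZigzagType n} {k i j : Fin n}
    (h : (τ.putSource k).Arrow i j) : j ≠ k := by
  rintro rfl
  obtain ⟨m, hm | hm⟩ := h
  · have h1 : m.val ≠ j.val := by omega
    have h2 : m.val + 1 = j.val := by omega
    simp [putSource, h1, h2] at hm
  · simp [putSource, hm.1] at hm

theorem Arrow.of_putSource {τ : ZigzagType n} {k i j : Fin n}
    (h : (τ.putSource k).Arrow i j) (hi : i ≠ k) : τ.Arrow i j := by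
  have hj := h.target_ne_of_putSource
  have hi' : i.val ≠ k.val := fun e => hi (Fin.ext e)
  have hj' : j.val ≠ k.val := fun e => hj (Fin.ext e)
  obtain ⟨m, hm⟩ := h
  have h1 : m.val ≠ k.val := by rcases hm with hm | hm <;> omega
  have h2 : m.val + 1 ≠ k.val := by rcases hm with hm | hm <;> omega
  exact ⟨m, by simpa [ArrowAt, putSource, h1, h2] using hm⟩

theorem Arrow.source_ne_of_putSink {τ : ZigzagType n} {k i j : Fin n}
    (h : (τ.putSink k).Arrow i j) : i ≠ k := by
  rintro rfl
  obtain ⟨m, hm | hm⟩ := h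
  · simp [putSink, hm.1] at hm
  · have h1 : m.val ≠ i.val := by omega
    have h2 : m.val + 1 = i.val := by omega
    simp [putSink, h1, h2] at hm

theorem Arrow.of_putSink {τ : ZigzagType n} {k i j : Fin n}
    (h : (τ.putSink k).Arrow i j) (hj : j ≠ k) : τ.Arrow i j := by
  have hi := h.source_ne_of_putSink
  have hi' : i.val ≠ k.val := fun e => hi (Fin.ext e)
  have hj' : j.val ≠ k.val := fun e => hj (Fin.ext e)
  obtain ⟨m, hm⟩ := h
  have h1 : m.val ≠ k.val := by rcases hm with hm | hm <;> omega
  have h2 : m.val + 1 ≠ k.val := by rcases hm with hm | hm <;> omega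
  exact ⟨m, by simpa [ArrowAt, putSink, h1, h2] using hm⟩

end ZigzagType

/-- The type `A` if the proposition `p` holds, and `B` otherwise. -/
def Slot (A B : Type u) {p : Prop} : Decidable p → Type u
  | isTrue _ => A
  | isFalse _ => B

namespace Slot

variable {F : Type u} [Field F] {A B : Type u} {p : Prop}

instance [AddCommGroup A] [AddCommGroup B] : (d : Decidable p) → AddCommGroup (Slot A B d)
  | isTrue _ => inferInstanceAs (AddCommGroup A)
  | isFalse _ => inferInstanceAs (AddCommGroup B)

instance [AddCommGroup A] [AddCommGroup B] [Module F A] [Module F B] :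
    (d : Decidable p) → Module F (Slot A B d)
  | isTrue _ => inferInstanceAs (Module F A)
  | isFalse _ => inferInstanceAs (Module F B)

variable [AddCommGroup A] [AddCommGroup B] [Module F A] [Module F B]

instance [FiniteDimensional F A] [FiniteDimensional F B] :
    (d : Decidable p) → FiniteDimensional F (Slot A B d)
  | isTrue _ => inferInstanceAs (FiniteDimensional F A)
  | isFalse _ => inferInstanceAs (FiniteDimensional F B)

variable (F A B)

/-- If `p` holds then `Slot A B` is `A` (this is the identity map). -/
def pos : (d : Decidable p) → p → Slot A B d ≃ₗ[F] A
  | isTrue _, _ => LinearEquiv.refl F A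
  | isFalse h, h' => absurd h' h

/-- If `p` fails then `Slot A B` is `B` (this is the identity map). -/
def neg : (d : Decidable p) → ¬ p → Slot A B d ≃ₗ[F] B
  | isTrue h, h' => absurd h h'
  | isFalse _, _ => LinearEquiv.refl F B

end Slot

/-- A zigzag module of type `τ`: finite-dimensional vector spaces at the positions `0, …, n - 1`
and a linear map along every arrow of `τ`. -/
structure ZigzagModule (F : Type u) [Field F] {n : ℕ} (τ : ZigzagType n) where
  space : Fin n → Type u
  [addCommGroup : ∀ i, AddCommGroup (space i)]
  [module : ∀ i, Module F (space i)]
  [finiteDimensional : ∀ i, FiniteDimensional F (space i)]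
  map : ∀ {i j : Fin n}, τ.Arrow i j → (space i →ₗ[F] space j)

namespace ZigzagModule

attribute [instance] addCommGroup module finiteDimensional

variable {F : Type u} [Field F] {n : ℕ} {τ : ZigzagType n}

/-- Isomorphisms of zigzag modules of the same type: bijective linear maps at all positions that
commute with the structure maps. -/
structure Iso (V W : ZigzagModule F τ) where
  equiv : ∀ i, V.space i ≃ₗ[F] W.space i
  comm : ∀ {i j : Fin n} (h : τ.Arrow i j) (x : V.space i),
    equiv j (V.map h x) = W.map h (equiv i x)

/-- Two zigzag modules of the same type are isomorphic. -/
def Isomorphic (V W : ZigzagModule F τ) : Prop := Nonempty (Iso V W)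

/-- The direct sum of two zigzag modules of the same type. -/
def directSum (V W : ZigzagModule F τ) : ZigzagModule F τ where
  space i := V.space i × W.space i
  map h := (V.map h).prodMap (W.map h)

/-- The direct sum of a finite family of zigzag modules of the same type. -/
def finiteSum {ι : Type} [Fintype ι] (V : ι → ZigzagModule F τ) : ZigzagModule F τ where
  space i := ∀ x : ι, (V x).space i
  map h := LinearMap.pi fun x => (V x).map h ∘ₗ LinearMap.proj x

/-- `W` is a summand of `V`. -/
def IsSummand (W V : ZigzagModule F τ) : Prop :=
  ∃ U : ZigzagModule F τ, Isomorphic V (directSum W U)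

/-- The interval module on `[I.fst, I.snd]`: the field `F` at the positions of the interval and `0`
elsewhere, with identity maps inside the interval and zero maps elsewhere. -/
def interval (F : Type u) [Field F] {n : ℕ} (τ : ZigzagType n) (I : NonemptyInterval (Fin n)) :
    ZigzagModule F τ where
  space i := Slot F PUnit.{u + 1} (inferInstance : Decidable (I.fst ≤ i ∧ i ≤ I.snd))
  map {i j} _ :=
    if h : (I.fst ≤ i ∧ i ≤ I.snd) ∧ (I.fst ≤ j ∧ j ≤ I.snd) then
      (Slot.pos F F PUnit _ h.2).symm.toLinearMap ∘ₗ (Slot.pos F F PUnit _ h.1).toLinearMap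
    else 0

/-- The direct sum of the interval modules on the members of a finite multiset of intervals, taken
with multiplicity. -/
noncomputable def intervalSum (F : Type u) [Field F] {n : ℕ} (τ : ZigzagType n)
    (D : Multiset (NonemptyInterval (Fin n))) : ZigzagModule F τ :=
  finiteSum fun x : D.ToType => interval F τ x.1

open Classical in
/-- The multiset of intervals in a decomposition of `V` into interval modules (which exists and is
unique by the theorems of Gabriel and Krull-Remak-Schmidt). -/
noncomputable def barcode (V : ZigzagModule F τ) : Multiset (NonemptyInterval (Fin n)) :=
  if h : ∃ D : Multiset (NonemptyInterval (Fin n)), Isomorphic V (intervalSum F τ D) then h.choose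
  else 0

/-- Remove the simple summands, i.e. those supported at one position. -/
noncomputable def removeSimple (V : ZigzagModule F τ) : ZigzagModule F τ :=
  intervalSum F τ (V.barcode.filter fun I => I.fst ≠ I.snd)

/-- The structure map number `l` is an isomorphism. -/
def IsIsoAt (V : ZigzagModule F τ) (l : Fin (n - 1)) : Prop :=
  ∀ {i j : Fin n} (h : τ.ArrowAt l i j), Function.Bijective (V.map ⟨l, h⟩)

/-- Reverse the arrow number `l`, whose structure map is an isomorphism, by replacing this map with
its inverse. -/
noncomputable def reverse (V : ZigzagModule F τ) (l : Fin (n - 1)) (hl : V.IsIsoAt l) :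
    ZigzagModule F (τ.reverse l) where
  space := V.space
  map {i j} h :=
    if he : ZigzagType.Ends l i j then
      (LinearEquiv.ofBijective (V.map ⟨l, h.of_reverse_ends he⟩)
        (hl (h.of_reverse_ends he))).symm.toLinearMap
    else V.map (h.of_reverse_not_ends he)

/-- At the ends of the zigzag, the diagram whose limit or colimit is taken is completed by a zero
space: `0 ↔ V₁ ↔ V₂` at the left end and `Vₙ₋₁ ↔ Vₙ ↔ 0` at the right end, where the arrow between
`0` and the end space has the direction `e`. This says that `k` is an end of the zigzag and that
such a zero map goes from `0` into the space at `k`. -/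
def ZeroInto (k : Fin n) (e : Dir) : Prop :=
  (k.val = 0 ∧ e = Dir.right) ∨ (k.val + 1 = n ∧ e = Dir.left)

/-- The same, but the zero map goes from the space at `k` to `0`. -/
def ZeroOutOf (k : Fin n) (e : Dir) : Prop :=
  (k.val = 0 ∧ e = Dir.left) ∨ (k.val + 1 = n ∧ e = Dir.right)

/-- The limit of the diagram formed by the space at `k`, its neighbours (zero spaces where there is
none) and the maps between them: the compatible families of vectors. A zero map from `0` into the
space at `k` forces the `k`-th vector to vanish, while a zero map to `0` imposes no condition. -/
def localLimit (V : ZigzagModule F τ) (k : Fin n) (e : Dir) :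
    Submodule F (∀ j : ZigzagType.Nbhd k, V.space j.1) where
  carrier := {x | (∀ (i j : ZigzagType.Nbhd k) (h : τ.Arrow i.1 j.1), V.map h (x i) = x j) ∧
    (ZeroInto k e → x (ZigzagType.Nbhd.center k) = 0)}
  add_mem' := by
    rintro x y ⟨hx, hx'⟩ ⟨hy, hy'⟩
    refine ⟨fun i j h => ?_, fun h => ?_⟩
    · simp [hx i j h, hy i j h]
    · simp [hx' h, hy' h]
  zero_mem' := ⟨fun i j h => by simp, fun _ => rfl⟩
  smul_mem' := by
    rintro c x ⟨hx, hx'⟩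
    refine ⟨fun i j h => ?_, fun h => ?_⟩
    · simp [hx i j h]
    · simp [hx' h]

/-- The relations defining the colimit of the diagram formed by the space at `k`, its neighbours
(zero spaces where there is none) and the maps between them: a vector is identified with its image
under every map of the diagram. In particular, if there is a zero map from the space at `k` to `0`
then every vector at `k` becomes zero. -/
def localRelations (V : ZigzagModule F τ) (k : Fin n) (e : Dir) :
    Submodule F (∀ j : ZigzagType.Nbhd k, V.space j.1) :=
  Submodule.span F
    ({z | ∃ (i j : ZigzagType.Nbhd k) (h : τ.Arrow i.1 j.1) (v : V.space i.1),
        z = Pi.single i v - Pi.single j (V.map h v)} ∪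
      {z | ZeroOutOf k e ∧ ∃ v : V.space k, z = Pi.single (ZigzagType.Nbhd.center k) v})

/-- The colimit of the diagram formed by the space at `k`, its neighbours and the maps between
them. -/
abbrev localColimit (V : ZigzagModule F τ) (k : Fin n) (e : Dir) : Type u :=
  (∀ j : ZigzagType.Nbhd k, V.space j.1) ⧸ V.localRelations k e

/-- Extroversion reflection at position `k`: the space at `k` is replaced with the limit of the
three-term diagram around `k`, and the arrows at `k` with the projections of the limit. -/
def extroversion (V : ZigzagModule F τ) (k : Fin n) (e : Dir) :
    ZigzagModule F (τ.putSource k) where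
  space j := Slot (V.localLimit k e) (V.space j) (inferInstance : Decidable (j = k))
  map {i j} h :=
    (Slot.neg F (V.localLimit k e) (V.space j) _ h.target_ne_of_putSource).symm.toLinearMap ∘ₗ
    if hi : i = k then
      LinearMap.proj (R := F) (φ := fun j : ZigzagType.Nbhd k => V.space j.1)
          ⟨j, hi ▸ h.target_mem⟩ ∘ₗ
        (V.localLimit k e).subtype ∘ₗ (Slot.pos F (V.localLimit k e) (V.space i) _ hi).toLinearMap
    else
      V.map (h.of_putSource hi) ∘ₗ (Slot.neg F (V.localLimit k e) (V.space i) _ hi).toLinearMap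

/-- Introversion reflection at position `k`: the space at `k` is replaced with the colimit of the
three-term diagram around `k`, and the arrows at `k` with the canonical maps to the colimit. -/
def introversion (V : ZigzagModule F τ) (k : Fin n) (e : Dir) :
    ZigzagModule F (τ.putSink k) where
  space j := Slot (V.localColimit k e) (V.space j) (inferInstance : Decidable (j = k))
  map {i j} h :=
    (if hj : j = k then
      (Slot.pos F (V.localColimit k e) (V.space j) _ hj).symm.toLinearMap ∘ₗ
        (V.localRelations k e).mkQ ∘ₗ
        LinearMap.single F (fun j : ZigzagType.Nbhd k => V.space j.1) ⟨i, hj ▸ h.source_mem⟩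
    else
      (Slot.neg F (V.localColimit k e) (V.space j) _ hj).symm.toLinearMap ∘ₗ
        V.map (h.of_putSink hj)) ∘ₗ
    (Slot.neg F (V.localColimit k e) (V.space i) _ h.source_ne_of_putSink).toLinearMap

end ZigzagModule

/-- All zigzag modules of length `n`. -/
abbrev NMod (F : Type u) [Field F] (n : ℕ) : Type (u + 1) := Σ τ : ZigzagType n, ZigzagModule F τ

/-- The reflection functors on zigzag modules of length `n`. The direction is that of the
additional zero map at an end of the zigzag, and plays no role at inner positions. -/
inductive Reflection (n : ℕ) : Type
  | extro (k : Fin n) (e : Dir) : Reflection n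
  | intro (k : Fin n) (e : Dir) : Reflection n

/-- The action of a reflection functor on zigzag modules. -/
def Reflection.apply {F : Type u} [Field F] {n : ℕ} : Reflection n → NMod F n → NMod F n
  | .extro k e, V => ⟨V.1.putSource k, V.2.extroversion k e⟩
  | .intro k e, V => ⟨V.1.putSink k, V.2.introversion k e⟩

namespace NMod

variable {F : Type u} [Field F] {n : ℕ}

/-- The equivalence relation on zigzag modules: `W` is isomorphic to a module obtained from `V` by
a finite (possibly empty) sequence of reversals of arrows that represent isomorphisms. -/
inductive Sim : NMod F n → NMod F n → Prop
  | of_iso {τ : ZigzagType n} {V W : ZigzagModule F τ} (h : V.Isomorphic W) :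
      Sim ⟨τ, V⟩ ⟨τ, W⟩
  | reverse {τ : ZigzagType n} {V : ZigzagModule F τ} {W : NMod F n} (l : Fin (n - 1))
      (hl : V.IsIsoAt l) (h : Sim ⟨τ.reverse l, V.reverse l hl⟩ W) : Sim ⟨τ, V⟩ W

/-- `W` is equivalent to a summand of `V`. -/
def Precsim (W V : NMod F n) : Prop :=
  ∃ W' : ZigzagModule F V.1, Sim W ⟨V.1, W'⟩ ∧ W'.IsSummand V.2

/-- Removal of the simple summands. -/
noncomputable def removeSimple (V : NMod F n) : NMod F n := ⟨V.1, V.2.removeSimple⟩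

/-- The action of a sequence of reflection functors (the head of the list is applied first); simple
summands are removed at the start and after every reflection. -/
noncomputable def applySeq : List (Reflection n) → NMod F n → NMod F n
  | [], V => V.removeSimple
  | r :: rs, V => applySeq rs (r.apply V.removeSimple)

/-- The `p`-cost of a sequence of reflections. -/
noncomputable def cost (p : ℝ) (R : List (Reflection n)) : ℝ :=
  if R = [] then 0 else (R.length : ℝ) ^ (1 / p)

/-- The `p`-reflection distance, for `p ∈ [1, ∞)`. -/
noncomputable def reflectionDistance (p : ℝ) (V W : NMod F n) : ℝ :=
  sInf {c : ℝ | ∃ R R' : List (Reflection n),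
    Precsim (applySeq R V) W ∧ Precsim (applySeq R' W) V ∧ c = max (cost p R) (cost p R')}

/-- The persistence diagram, as a multiset of points of the plane. Positions are counted from `1`
here. -/
noncomputable def diagram (V : NMod F n) : Multiset (ℝ × ℝ) :=
  V.2.barcode.map fun I => ((I.fst.val : ℝ) + 1, (I.snd.val : ℝ) + 1)

end NMod

namespace Bottleneck

/-- The cost of leaving a point unmatched; `(1 / p).toReal` is `0` for `p = ∞`. -/
noncomputable def unmatchedCost (p : ℝ≥0∞) (r : ℝ × ℝ) : ℝ :=
  |r.2 - r.1| / (2 : ℝ) ^ (1 - (1 / p).toReal)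

/-- The cost of a matching, i.e. a partial bijection, between two finite multisets of points: the
largest of the `ℓᵖ` distances between matched points and of the costs of the unmatched points (`0`
if there are no points at all). -/
noncomputable def cost (p : ℝ≥0∞) {S T : Multiset (ℝ × ℝ)} (M : S.ToType ≃. T.ToType) : ℝ :=
  sSup ({c | ∃ s t, t ∈ M s ∧ c = ‖WithLp.toLp p (s.1 - t.1)‖} ∪
    {c | ∃ s, M s = none ∧ c = unmatchedCost p s.1} ∪
    {c | ∃ t, M.symm t = none ∧ c = unmatchedCost p t.1})

/-- The `ℓᵖ`-bottleneck distance, for `p ∈ [1, ∞]`. -/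
noncomputable def dist (p : ℝ≥0∞) (S T : Multiset (ℝ × ℝ)) : ℝ :=
  ⨅ M : S.ToType ≃. T.ToType, cost p M

end Bottleneck

/-!
The bound is proved on barcodes. A reflection acts on an interval module of positive length by
keeping it, or by moving one of its ends by one step; it never kills it, since an interval with two
positions keeps one of them. As limits and colimits commute with direct sums, a sequence of `ℓ`
reflections with removal of simple summands acts on a barcode interval by interval: each interval is
either moved by at most `ℓ`, or it shrinks to a simple interval at some stage and is removed, and
then its length was at most `ℓ` (`NMod.exists_barcode_applySeq`). The relation `≾` gives an
inclusion of barcodes (`NMod.Precsim.barcode_le`). So two sequences as in the definition of the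
reflection distance give injections from parts of each barcode to the other one that move intervals
by at most the cost and are defined at least on the intervals longer than the cost. A
Cantor–Schröder–Bernstein argument (`PEquiv.exists_of_injective`) combines them into one matching
whose pairs all come from one of the injections and which covers all long intervals. Finally, every
module can be reduced to zero by reflections, so that the infimum in the definition of the
reflection distance is taken over a nonempty set (`NMod.exists_applySeq_precsim`).

Two facts about zigzag modules are needed on the way. Decompositions into interval modules exist
(`ZigzagModule.exists_adaptedBasis`): the space at the last nonzero position has a filtration whose
steps consist of vectors and functionals that extend to the left along the same interval, and a
nontrivial step yields an interval summand. Decompositions are unique, and monotone under retracts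
(`ZigzagModule.AdaptedBasis.map_le_of_retract`), because compositions `I → J → I` between different
interval modules vanish. All constructions are carried out on bases adapted to a decomposition,
together with their dual bases (`ZigzagModule.AdaptedBasis`).
-/

/-! ### Bases adapted to interval decompositions -/

namespace ZigzagModule

variable {F : Type u} [Field F] {n : ℕ} {τ : ZigzagType n} {V W : ZigzagModule F τ}

/-- A basis of `V` adapted to a family of supports: for each index `x`, vectors `vec x i` at the
positions `i ∈ supp x` that the structure maps carry to each other (and to `0` outside `supp x`),
such that the vectors with `i ∈ supp x` form a basis of the space at `i`. The dual basis `cov` is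
part of the data; both families are extended by `0` outside the supports. -/
structure AdaptedBasis (V : ZigzagModule F τ) (X : Type) [Fintype X]
    (supp : X → Set (Fin n)) where
  vec : ∀ (_ : X) i, V.space i
  cov : ∀ (_ : X) i, V.space i →ₗ[F] F
  vec_eq_zero : ∀ {x i}, i ∉ supp x → vec x i = 0
  cov_eq_zero : ∀ {x i}, i ∉ supp x → cov x i = 0
  cov_vec_self : ∀ {x i}, i ∈ supp x → cov x i (vec x i) = 1
  cov_vec_of_ne : ∀ {x y} i, x ≠ y → cov x i (vec y i) = 0
  sum_cov : ∀ i (a : V.space i), ∑ x, cov x i a • vec x i = a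
  map_vec : ∀ {i j} (h : τ.Arrow i j) {x}, i ∈ supp x → j ∈ supp x →
    V.map h (vec x i) = vec x j
  map_vec_eq_zero : ∀ {i j} (h : τ.Arrow i j) {x}, j ∉ supp x → V.map h (vec x i) = 0

namespace AdaptedBasis

variable {X Y : Type} [Fintype X] [Fintype Y] {supp : X → Set (Fin n)}

theorem cov_map_vec_of_ne (B : V.AdaptedBasis X supp) {i j : Fin n} (h : τ.Arrow i j) {x y : X}
    (hxy : x ≠ y) : B.cov x j (V.map h (B.vec y i)) = 0 := by
  by_cases hj : j ∈ supp y
  · by_cases hi : i ∈ supp y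
    · rw [B.map_vec h hi hj, B.cov_vec_of_ne j hxy]
    · rw [B.vec_eq_zero hi, map_zero, map_zero]
  · rw [B.map_vec_eq_zero h hj, map_zero]

theorem cov_map_eq_mul (B : V.AdaptedBasis X supp) {i j : Fin n} (h : τ.Arrow i j) (x : X)
    (a : V.space i) : B.cov x j (V.map h a) = B.cov x i a * B.cov x j (V.map h (B.vec x i)) := by
  conv_lhs => rw [← B.sum_cov i a]
  rw [map_sum, map_sum, Finset.sum_eq_single x]
  · simp
  · intro y _ hy
    rw [map_smul, map_smul, B.cov_map_vec_of_ne h hy.symm, smul_zero]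
  · simp

theorem cov_map (B : V.AdaptedBasis X supp) {i j : Fin n} (h : τ.Arrow i j) {x : X}
    (hi : i ∈ supp x) (hj : j ∈ supp x) (a : V.space i) :
    B.cov x j (V.map h a) = B.cov x i a := by
  rw [B.cov_map_eq_mul, B.map_vec h hi hj, B.cov_vec_self hj, mul_one]

theorem cov_map_eq_zero (B : V.AdaptedBasis X supp) {i j : Fin n} (h : τ.Arrow i j) {x : X}
    (hi : i ∉ supp x) (a : V.space i) : B.cov x j (V.map h a) = 0 := by
  rw [B.cov_map_eq_mul, B.cov_eq_zero hi, LinearMap.zero_apply, zero_mul]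

theorem ext_cov (B : V.AdaptedBasis X supp) {i : Fin n} {a b : V.space i}
    (h : ∀ x, B.cov x i a = B.cov x i b) : a = b := by
  rw [← B.sum_cov i a, ← B.sum_cov i b]
  simp [h]

/-- Adapted bases with the same supports give an isomorphism that matches them up. -/
theorem isomorphic (B : V.AdaptedBasis X supp) (C : W.AdaptedBasis X supp) :
    V.Isomorphic W := by
  have key : ∀ {V W : ZigzagModule F τ} (B : V.AdaptedBasis X supp) (C : W.AdaptedBasis X supp)
      (x : X) (i : Fin n) (a : V.space i),
      C.cov x i (∑ y, B.cov y i a • C.vec y i) = B.cov x i a := by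
    intro V W B C x i a
    rw [map_sum, Finset.sum_eq_single x]
    · by_cases hi : i ∈ supp x
      · simp [C.cov_vec_self hi]
      · simp [B.cov_eq_zero hi, C.cov_eq_zero hi]
    · intro y _ hy
      rw [map_smul, C.cov_vec_of_ne i hy.symm, smul_zero]
    · simp
  refine ⟨⟨fun i => LinearEquiv.ofLinearMap
    (∑ x, (B.cov x i).smulRight (C.vec x i)) (∑ x, (C.cov x i).smulRight (B.vec x i)) ?_ ?_, ?_⟩⟩
  · ext a
    apply C.ext_cov
    intro x
    simp only [LinearMap.comp_apply, LinearMap.sum_apply, LinearMap.smulRight_apply,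
      LinearMap.id_apply]
    rw [key B C, key C B]
  · ext a
    apply B.ext_cov
    intro x
    simp only [LinearMap.comp_apply, LinearMap.sum_apply, LinearMap.smulRight_apply,
      LinearMap.id_apply]
    rw [key C B, key B C]
  · intro i j h a
    apply C.ext_cov
    intro x
    simp only [LinearEquiv.coe_ofLinearMap, LinearMap.sum_apply, LinearMap.smulRight_apply]
    rw [key B C]
    by_cases hi : i ∈ supp x
    · by_cases hj : j ∈ supp x
      · rw [B.cov_map h hi hj, C.cov_map h hi hj, key B C]
      · rw [B.cov_eq_zero hj, C.cov_eq_zero hj, LinearMap.zero_apply, LinearMap.zero_apply]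
    · rw [B.cov_map_eq_zero h hi, C.cov_map_eq_zero h hi]

/-- Transport of an adapted basis along an isomorphism. -/
def ofIso (B : V.AdaptedBasis X supp) (f : Iso V W) : W.AdaptedBasis X supp where
  vec x i := f.equiv i (B.vec x i)
  cov x i := B.cov x i ∘ₗ (f.equiv i).symm.toLinearMap
  vec_eq_zero h := by rw [B.vec_eq_zero h, map_zero]
  cov_eq_zero h := by rw [B.cov_eq_zero h, LinearMap.zero_comp]
  cov_vec_self h := by simp [B.cov_vec_self h]
  cov_vec_of_ne i h := by simp [B.cov_vec_of_ne i h]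
  sum_cov i a := by
    apply (f.equiv i).symm.injective
    simp [B.sum_cov]
  map_vec h x hi hj := by rw [← f.comm, B.map_vec h hi hj]
  map_vec_eq_zero h x hj := by rw [← f.comm, B.map_vec_eq_zero h hj, map_zero]

/-- Change of the index type of an adapted basis. -/
def reindex (B : V.AdaptedBasis X supp) (e : X ≃ Y) {supp' : Y → Set (Fin n)}
    (he : ∀ x, supp' (e x) = supp x) : V.AdaptedBasis Y supp' where
  vec y := B.vec (e.symm y)
  cov y := B.cov (e.symm y)
  vec_eq_zero h := B.vec_eq_zero (by rwa [← he, e.apply_symm_apply])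
  cov_eq_zero h := B.cov_eq_zero (by rwa [← he, e.apply_symm_apply])
  cov_vec_self h := B.cov_vec_self (by rwa [← he, e.apply_symm_apply])
  cov_vec_of_ne i h := B.cov_vec_of_ne i (by simpa using h)
  sum_cov i a := (e.symm.sum_comp fun x => B.cov x i a • B.vec x i).trans (B.sum_cov i a)
  map_vec h x hi hj := B.map_vec h (by rwa [← he, e.apply_symm_apply])
    (by rwa [← he, e.apply_symm_apply])
  map_vec_eq_zero h x hj := B.map_vec_eq_zero h (by rwa [← he, e.apply_symm_apply])

end AdaptedBasis

/-- The space of an interval module at a position of the interval is the field. -/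
def intervalEquiv (τ : ZigzagType n) (I : NonemptyInterval (Fin n)) {i : Fin n}
    (h : I.fst ≤ i ∧ i ≤ I.snd) : (interval F τ I).space i ≃ₗ[F] F :=
  Slot.pos F F PUnit _ h

theorem interval_space_subsingleton (I : NonemptyInterval (Fin n)) {i : Fin n}
    (h : ¬ (I.fst ≤ i ∧ i ≤ I.snd)) : Subsingleton ((interval F τ I).space i) :=
  (Slot.neg F F PUnit (inferInstance : Decidable (I.fst ≤ i ∧ i ≤ I.snd)) h).toEquiv.subsingleton

theorem interval_map_apply (I : NonemptyInterval (Fin n)) {i j : Fin n} (h : τ.Arrow i j)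
    (hi : I.fst ≤ i ∧ i ≤ I.snd) (hj : I.fst ≤ j ∧ j ≤ I.snd) (a : (interval F τ I).space i) :
    (interval F τ I).map h a = (intervalEquiv τ I hj).symm (intervalEquiv τ I hi a) :=
  congrArg (fun f : (interval F τ I).space i →ₗ[F] (interval F τ I).space j => f a)
    (dif_pos (And.intro hi hj))

/-- The generator `1` of an interval module at a position of the interval, and `0` elsewhere. -/
def intervalGen (F : Type u) [Field F] (τ : ZigzagType n) (I : NonemptyInterval (Fin n))
    (i : Fin n) : (interval F τ I).space i :=
  if h : I.fst ≤ i ∧ i ≤ I.snd then (intervalEquiv τ I h).symm 1 else 0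

/-- The coordinate with respect to `intervalGen`. -/
def intervalCoord (F : Type u) [Field F] (τ : ZigzagType n) (I : NonemptyInterval (Fin n))
    (i : Fin n) : (interval F τ I).space i →ₗ[F] F :=
  if h : I.fst ≤ i ∧ i ≤ I.snd then (intervalEquiv τ I h).toLinearMap else 0

theorem intervalCoord_gen (I : NonemptyInterval (Fin n)) {i : Fin n}
    (h : I.fst ≤ i ∧ i ≤ I.snd) : intervalCoord F τ I i (intervalGen F τ I i) = 1 := by
  simp only [intervalCoord, intervalGen, dif_pos h]
  simp

theorem intervalCoord_smul_gen (I : NonemptyInterval (Fin n)) {i : Fin n}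
    (a : (interval F τ I).space i) :
    intervalCoord F τ I i a • intervalGen F τ I i = a := by
  by_cases h : I.fst ≤ i ∧ i ≤ I.snd
  · simp only [intervalCoord, intervalGen, dif_pos h]
    rw [← map_smul]
    simp
  · have := interval_space_subsingleton (F := F) (τ := τ) I h
    exact Subsingleton.elim _ _

theorem map_intervalGen (I : NonemptyInterval (Fin n)) {i j : Fin n} (h : τ.Arrow i j)
    (hi : I.fst ≤ i ∧ i ≤ I.snd) (hj : I.fst ≤ j ∧ j ≤ I.snd) :
    (interval F τ I).map h (intervalGen F τ I i) = intervalGen F τ I j := by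
  rw [interval_map_apply I h hi hj]
  simp only [intervalGen, dif_pos hi, dif_pos hj]
  simp

section FiniteSum

variable {X : Type} [Fintype X] (M : X → ZigzagModule F τ)

/-- The projections of a direct sum. -/
def finiteSumProj (x : X) (i : Fin n) : (finiteSum M).space i →ₗ[F] (M x).space i :=
  LinearMap.proj (R := F) (φ := fun x => (M x).space i) x

open Classical in
/-- The inclusions of the summands of a direct sum. -/
noncomputable def finiteSumSingle (x : X) (i : Fin n) :
    (M x).space i →ₗ[F] (finiteSum M).space i :=
  LinearMap.single F (fun x => (M x).space i) x

variable {M}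

theorem finiteSum_ext {i : Fin n} {a b : (finiteSum M).space i}
    (h : ∀ x, finiteSumProj M x i a = finiteSumProj M x i b) : a = b := funext h

theorem finiteSumProj_map (x : X) {i j : Fin n} (h : τ.Arrow i j) (a : (finiteSum M).space i) :
    finiteSumProj M x j ((finiteSum M).map h a) = (M x).map h (finiteSumProj M x i a) := rfl

theorem finiteSumProj_single (x : X) (i : Fin n) (a : (M x).space i) :
    finiteSumProj M x i (finiteSumSingle M x i a) = a := by
  classical exact Pi.single_eq_same (M := fun x => (M x).space i) x a

theorem finiteSumProj_single_of_ne {x y : X} (h : x ≠ y) (i : Fin n) (a : (M y).space i) :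
    finiteSumProj M x i (finiteSumSingle M y i a) = 0 := by
  classical exact Pi.single_eq_of_ne (M := fun x => (M x).space i) h a

theorem map_finiteSumSingle (x : X) {i j : Fin n} (h : τ.Arrow i j) (a : (M x).space i) :
    (finiteSum M).map h (finiteSumSingle M x i a) = finiteSumSingle M x j ((M x).map h a) := by
  apply finiteSum_ext
  intro y
  rw [finiteSumProj_map]
  by_cases hy : y = x
  · subst hy
    rw [finiteSumProj_single, finiteSumProj_single]
  · rw [finiteSumProj_single_of_ne hy, finiteSumProj_single_of_ne hy, map_zero]

end FiniteSum

/-- The standard adapted basis of a direct sum of interval modules. -/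
noncomputable def AdaptedBasis.finiteSum {X : Type} [Fintype X]
    (I : X → NonemptyInterval (Fin n)) :
    (finiteSum fun x => interval F τ (I x)).AdaptedBasis X
      fun x => Set.Icc (I x).fst (I x).snd where
  vec x i := finiteSumSingle (fun x => interval F τ (I x)) x i (intervalGen F τ (I x) i)
  cov x i := intervalCoord F τ (I x) i ∘ₗ finiteSumProj (fun x => interval F τ (I x)) x i
  vec_eq_zero {x i} h := by
    have : intervalGen F τ (I x) i = 0 := dif_neg h
    rw [this, map_zero]
  cov_eq_zero {x i} h := by
    have : intervalCoord F τ (I x) i = 0 := dif_neg h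
    rw [this, LinearMap.zero_comp]
  cov_vec_self {x i} h := by
    rw [LinearMap.comp_apply, finiteSumProj_single]
    exact intervalCoord_gen (I x) h
  cov_vec_of_ne {x y} i h := by
    rw [LinearMap.comp_apply, finiteSumProj_single_of_ne h, map_zero]
  sum_cov i a := by
    apply finiteSum_ext
    intro x
    rw [map_sum, Finset.sum_eq_single x]
    · rw [map_smul, finiteSumProj_single, LinearMap.comp_apply]
      exact intervalCoord_smul_gen (I x) _
    · intro y _ hy
      rw [map_smul, finiteSumProj_single_of_ne hy.symm, smul_zero]
    · simp
  map_vec {i j} h x hi hj := by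
    rw [map_finiteSumSingle]
    exact congrArg _ (map_intervalGen (I x) h hi hj)
  map_vec_eq_zero {i j} h x hj := by
    rw [map_finiteSumSingle]
    have := interval_space_subsingleton (F := F) (τ := τ) (I x) hj
    rw [Subsingleton.elim ((interval F τ (I x)).map h _) 0, map_zero]

end ZigzagModule

/-! ### Uniqueness of interval decompositions -/

theorem ZigzagType.exists_arrow_or {n : ℕ} (τ : ZigzagType n) {i j : Fin n}
    (h : j.val = i.val + 1) : τ.Arrow i j ∨ τ.Arrow j i := by
  have hl : i.val < n - 1 := by omega
  cases hd : τ ⟨i.val, hl⟩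
  · exact Or.inl ⟨⟨i.val, hl⟩, Or.inl ⟨rfl, h, hd⟩⟩
  · exact Or.inr ⟨⟨i.val, hl⟩, Or.inr ⟨rfl, h, hd⟩⟩

/-- A function that takes the same value at the two ends of every arrow inside an interval is
constant on the interval. -/
theorem ZigzagType.eq_of_mem_Icc {n : ℕ} {α : Type*} (τ : ZigzagType n) {a b : Fin n}
    (c : Fin n → α)
    (hc : ∀ {i j}, τ.Arrow i j → i ∈ Set.Icc a b → j ∈ Set.Icc a b → c i = c j)
    {p q : Fin n} (hp : p ∈ Set.Icc a b) (hq : q ∈ Set.Icc a b) : c p = c q := by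
  have key : ∀ m : ℕ, ∀ q : Fin n, q ∈ Set.Icc a b → q.val = a.val + m → c q = c a := by
    intro m
    induction m with
    | zero => intro q _ h; rw [Fin.ext h]
    | succ m ih =>
      intro q hq h
      have hq' := hq
      rw [Set.mem_Icc, Fin.le_def, Fin.le_def] at hq'
      have hr : (⟨a.val + m, by omega⟩ : Fin n) ∈ Set.Icc a b := by
        rw [Set.mem_Icc, Fin.le_def, Fin.le_def]
        exact ⟨by simp, by simp only; omega⟩
      rw [← ih _ hr rfl]
      rcases τ.exists_arrow_or (i := ⟨a.val + m, by omega⟩) (j := q)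
        (by simp only; omega) with h | h
      · exact (hc h hr hq).symm
      · exact hc h hq hr
  rw [key (p.val - a.val) p hp (by have := Fin.le_def.1 hp.1; omega),
    key (q.val - a.val) q hq (by have := Fin.le_def.1 hq.1; omega)]

namespace ZigzagModule

variable {F : Type u} [Field F] {n : ℕ} {τ : ZigzagType n} {V W : ZigzagModule F τ}

/-- A homomorphism of zigzag modules of the same type. -/
structure Hom (V W : ZigzagModule F τ) where
  toFun : ∀ i, V.space i →ₗ[F] W.space i
  comm : ∀ {i j : Fin n} (h : τ.Arrow i j) (x : V.space i),
    toFun j (V.map h x) = W.map h (toFun i x)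

namespace AdaptedBasis

variable {X Y : Type} [Fintype X] [Fintype Y] {supp : X → Set (Fin n)} {supp' : Y → Set (Fin n)}

/-- The matrix entry at position `i` of a homomorphism with respect to adapted bases. -/
def entry (B : V.AdaptedBasis X supp) (C : W.AdaptedBasis Y supp') (f : Hom V W) (i : Fin n)
    (y : Y) (x : X) : F :=
  C.cov y i (f.toFun i (B.vec x i))

variable {B : V.AdaptedBasis X supp} {C : W.AdaptedBasis Y supp'}

theorem entry_eq (f : Hom V W) {i j : Fin n} (h : τ.Arrow i j) {x : X} {y : Y}
    (hi : i ∈ supp x) (hj : j ∈ supp x) (hi' : i ∈ supp' y) (hj' : j ∈ supp' y) :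
    B.entry C f i y x = B.entry C f j y x := by
  rw [entry, entry, ← B.map_vec h hi hj, f.comm, C.cov_map h hi' hj']

theorem entry_eq_zero_of_source (f : Hom V W) {i : Fin n} {x : X} (y : Y) (hi : i ∉ supp x) :
    B.entry C f i y x = 0 := by
  rw [entry, B.vec_eq_zero hi, map_zero, map_zero]

theorem entry_eq_zero_of_target (f : Hom V W) {i : Fin n} (x : X) {y : Y} (hi : i ∉ supp' y) :
    B.entry C f i y x = 0 := by
  rw [entry, C.cov_eq_zero hi, LinearMap.zero_apply]

/-- If the support of `x` ends at an arrow along which that of `y` continues, then there is no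
nonzero homomorphism from the first interval module to the second one. -/
theorem entry_eq_zero_of_arrow (f : Hom V W) {i j : Fin n} (h : τ.Arrow i j) {x : X} {y : Y}
    (hj : j ∉ supp x) (hi' : i ∈ supp' y) (hj' : j ∈ supp' y) : B.entry C f i y x = 0 := by
  rw [entry, ← C.cov_map h hi' hj', ← f.comm, B.map_vec_eq_zero h hj, map_zero, map_zero]

/-- If `x`, `x'` have the same support and `y`, `y'` have the same support, then the products of
entries at `y ← x` and at `x' ← y'` take the same value at the two ends of an arrow inside the
support of `x`. -/
theorem entry_mul_entry_eq (f : Hom V W) (g : Hom W V) {i j : Fin n} (h : τ.Arrow i j) {x x' : X}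
    (hx : supp x = supp x') {y y' : Y} (hy : supp' y = supp' y') (hi : i ∈ supp x)
    (hj : j ∈ supp x) :
    C.entry B g i x' y' * B.entry C f i y x = C.entry B g j x' y' * B.entry C f j y x := by
  by_cases hi' : i ∈ supp' y
  · by_cases hj' : j ∈ supp' y
    · rw [entry_eq f h hi hj hi' hj', entry_eq g h (hy ▸ hi') (hy ▸ hj') (hx ▸ hi) (hx ▸ hj)]
    · rw [entry_eq_zero_of_target f x hj',
        entry_eq_zero_of_arrow g h (hy ▸ hj') (hx ▸ hi) (hx ▸ hj), zero_mul, mul_zero]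
  · rw [entry_eq_zero_of_target f x hi', entry, entry, entry, ← B.map_vec h hi hj, f.comm,
      C.cov_map_eq_zero h hi', mul_zero, mul_zero]

variable {I : X → NonemptyInterval (Fin n)} {J : Y → NonemptyInterval (Fin n)}
  {B : V.AdaptedBasis X fun x => Set.Icc (I x).fst (I x).snd}
  {C : W.AdaptedBasis Y fun y => Set.Icc (J y).fst (J y).snd}

/-- A composition `I → J → I` of homomorphisms between different interval modules vanishes. -/
theorem entry_mul_entry_eq_zero (f : Hom V W) (g : Hom W V) {x x' : X} (hx : I x = I x') {y : Y}
    (hy : J y ≠ I x) (p : Fin n) : C.entry B g p x' y * B.entry C f p y x = 0 := by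
  by_contra h0
  have hp : p ∈ Set.Icc (I x).fst (I x).snd := by
    by_contra hp
    exact h0 (by rw [entry_eq_zero_of_source (B := B) (C := C) (x := x) f y hp, mul_zero])
  have hp' : p ∈ Set.Icc (J y).fst (J y).snd := by
    by_contra hp
    exact h0 (by rw [entry_eq_zero_of_target (B := B) (C := C) (y := y) f x hp, mul_zero])
  have h1 : ∀ q ∈ Set.Icc (I x).fst (I x).snd, q ∈ Set.Icc (J y).fst (J y).snd := by
    intro q hq
    by_contra hq'
    have := τ.eq_of_mem_Icc (fun q => C.entry B g q x' y * B.entry C f q y x)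
      (fun h hi hj => entry_mul_entry_eq f g h (by simp only [hx]) rfl hi hj) hp hq
    simp only [entry_eq_zero_of_target (B := B) (C := C) (y := y) f x hq', mul_zero] at this
    exact h0 this
  have h2 : ∀ q ∈ Set.Icc (J y).fst (J y).snd, q ∈ Set.Icc (I x).fst (I x).snd := by
    intro q hq
    by_contra hq'
    have := τ.eq_of_mem_Icc (fun q => B.entry C f q y x * C.entry B g q x' y)
      (fun h hi hj => entry_mul_entry_eq g f h rfl (by simp only [hx]) hi hj) hp' hq
    simp only [entry_eq_zero_of_source (B := B) (C := C) (x := x) f y hq', zero_mul] at this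
    exact h0 (by rw [mul_comm, this])
  apply hy
  have a1 := h1 _ ⟨le_rfl, (I x).fst_le_snd⟩
  have a2 := h1 _ ⟨(I x).fst_le_snd, le_rfl⟩
  have a3 := h2 _ ⟨le_rfl, (J y).fst_le_snd⟩
  have a4 := h2 _ ⟨(J y).fst_le_snd, le_rfl⟩
  exact NonemptyInterval.ext (Prod.ext (le_antisymm a1.1 a3.1) (le_antisymm a4.2 a2.2))

theorem sum_entry_mul_entry (f : Hom V W) (g : Hom W V)
    (hgf : ∀ i a, g.toFun i (f.toFun i a) = a) (x x' : X) (p : Fin n) :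
    ∑ y, C.entry B g p x' y * B.entry C f p y x = B.cov x' p (B.vec x p) := by
  conv_rhs => rw [← hgf p (B.vec x p), ← C.sum_cov p (f.toFun p (B.vec x p))]
  simp only [map_sum, map_smul, smul_eq_mul, entry]
  exact Finset.sum_congr rfl fun y _ => mul_comm _ _

/-- The matrices of the two homomorphisms that present `V` as a retract of `W`, restricted to the
summands isomorphic to a given interval module `K`, are mutually inverse on one side: compositions
through the other summands of `W` vanish. -/
theorem card_le_of_retract (B : V.AdaptedBasis X fun x => Set.Icc (I x).fst (I x).snd)
    (C : W.AdaptedBasis Y fun y => Set.Icc (J y).fst (J y).snd) (f : Hom V W) (g : Hom W V)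
    (hgf : ∀ i a, g.toFun i (f.toFun i a) = a) (K : NonemptyInterval (Fin n)) :
    Fintype.card {x // I x = K} ≤ Fintype.card {y // J y = K} := by
  classical
  let p := K.fst
  let A : Matrix {y // J y = K} {x // I x = K} F := fun y x => B.entry C f p y.1 x.1
  let A' : Matrix {x // I x = K} {y // J y = K} F := fun x y => C.entry B g p x.1 y.1
  have hA : A' * A = 1 := by
    ext x' x
    have hx : I x.1 = I x'.1 := x.2.trans x'.2.symm
    have hs : (A' * A) x' x = ∑ y, C.entry B g p x'.1 y * B.entry C f p y x.1 := by
      rw [Matrix.mul_apply, ← Finset.sum_filter_of_ne (p := fun y => J y = K)]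
      · exact (Finset.sum_subtype (Finset.univ.filter fun y => J y = K) (by simp)
          fun y => C.entry B g p x'.1 y * B.entry C f p y x.1).symm
      · intro y _ hy
        by_contra h
        exact hy (entry_mul_entry_eq_zero f g hx (by rwa [x.2]) p)
    rw [hs, sum_entry_mul_entry f g hgf]
    by_cases h : x' = x
    · subst h
      rw [Matrix.one_apply_eq]
      apply B.cov_vec_self
      rw [x'.2]
      exact ⟨le_rfl, K.fst_le_snd⟩
    · rw [Matrix.one_apply_ne h, B.cov_vec_of_ne]
      exact fun e => h (Subtype.ext e)
  calc Fintype.card {x // I x = K} = (A' * A).rank := by rw [hA, Matrix.rank_one]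
    _ ≤ A.rank := Matrix.rank_mul_le_right _ _
    _ ≤ _ := Matrix.rank_le_card_height _

theorem map_le_of_retract (B : V.AdaptedBasis X fun x => Set.Icc (I x).fst (I x).snd)
    (C : W.AdaptedBasis Y fun y => Set.Icc (J y).fst (J y).snd) (f : Hom V W) (g : Hom W V)
    (hgf : ∀ i a, g.toFun i (f.toFun i a) = a) :
    Finset.univ.val.map I ≤ Finset.univ.val.map J := by
  classical
  have hc : ∀ {X : Type} [Fintype X] (I : X → NonemptyInterval (Fin n)) K,
      (Finset.univ.val.map I).count K = Fintype.card {x // I x = K} := by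
    intro X _ I K
    rw [Multiset.count_map, Fintype.card_subtype]
    simp only [Finset.card, Finset.filter_val, eq_comm]
  rw [Multiset.le_iff_count]
  intro K
  rw [hc, hc]
  exact card_le_of_retract B C f g hgf K

end AdaptedBasis

/-- The identity homomorphism. -/
def Hom.id (V : ZigzagModule F τ) : Hom V V := ⟨fun _ => LinearMap.id, fun _ _ => rfl⟩

end ZigzagModule

/-- A finite family with values in `E`, counted with multiplicity, can be lifted to an injection
into `E`. -/
theorem Multiset.exists_injective_of_map_le {X β : Type*} [Fintype X] [DecidableEq β] {h : X → β}
    {E : Multiset β} (hE : Finset.univ.val.map h ≤ E) :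
    ∃ j : X → E.ToType, Function.Injective j ∧ ∀ x, (j x).1 = h x := by
  classical
  have hcard : ∀ b, Fintype.card {x // h x = b} ≤ Fintype.card (Fin (E.count b)) := by
    intro b
    rw [Fintype.card_fin]
    refine le_trans (le_of_eq ?_) (Multiset.le_iff_count.1 hE b)
    rw [Multiset.count_map, Fintype.card_subtype]
    simp only [Finset.card, Finset.filter_val, eq_comm]
  let e b := Classical.choice (Function.Embedding.nonempty_of_card_le (hcard b))
  refine ⟨fun x => ⟨h x, e (h x) ⟨x, rfl⟩⟩, ?_, fun x => rfl⟩
  have key : ∀ b b' (x : {x // h x = b}) (x' : {x // h x = b'}),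
      (⟨b, e b x⟩ : (b : β) × Fin (E.count b)) = ⟨b', e b' x'⟩ → x.1 = x'.1 := by
    intro b b' x x' hh
    obtain rfl : b = b' := congrArg Sigma.fst hh
    rw [(e b).injective (eq_of_heq (Sigma.mk.inj hh).2)]
  exact fun x x' hh => key _ _ ⟨x, rfl⟩ ⟨x', rfl⟩ hh

theorem Multiset.exists_equiv_of_map_eq {X β : Type*} [Fintype X] [DecidableEq β] {h : X → β}
    {E : Multiset β} (hE : Finset.univ.val.map h = E) :
    ∃ j : X ≃ E.ToType, ∀ x, (j x).1 = h x := by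
  obtain ⟨j, hj, hj'⟩ := Multiset.exists_injective_of_map_le hE.le
  have : Function.Bijective j := by
    rw [Fintype.bijective_iff_injective_and_card]
    refine ⟨hj, ?_⟩
    rw [Multiset.card_coe, ← hE, Multiset.card_map]
    rfl
  exact ⟨Equiv.ofBijective j this, hj'⟩

namespace ZigzagModule

variable {F : Type u} [Field F] {n : ℕ} {τ : ZigzagType n} {V W : ZigzagModule F τ}

/-- The adapted basis of `intervalSum`, indexed by the members of the multiset. -/
noncomputable def intervalSumBasis (F : Type u) [Field F] (τ : ZigzagType n)
    (D : Multiset (NonemptyInterval (Fin n))) :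
    (intervalSum F τ D).AdaptedBasis D.ToType fun x => Set.Icc x.1.fst x.1.snd :=
  AdaptedBasis.finiteSum fun x : D.ToType => x.1

theorem AdaptedBasis.isomorphic_intervalSum {X : Type} [Fintype X]
    {I : X → NonemptyInterval (Fin n)}
    (B : V.AdaptedBasis X fun x => Set.Icc (I x).fst (I x).snd) :
    V.Isomorphic (intervalSum F τ (Finset.univ.val.map I)) := by
  classical
  obtain ⟨e, he⟩ := Multiset.exists_equiv_of_map_eq (h := I) rfl
  exact (B.reindex e fun x => by rw [he]).isomorphic (intervalSumBasis F τ _)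

/-- Uniqueness of the decomposition into interval modules. -/
theorem AdaptedBasis.barcode_eq {X : Type} [Fintype X] {I : X → NonemptyInterval (Fin n)}
    (B : V.AdaptedBasis X fun x => Set.Icc (I x).fst (I x).snd) :
    V.barcode = Finset.univ.val.map I := by
  classical
  have h : ∃ D : Multiset (NonemptyInterval (Fin n)), Isomorphic V (intervalSum F τ D) :=
    ⟨_, B.isomorphic_intervalSum⟩
  have h1 : V.barcode = h.choose := by
    rw [barcode]
    convert dif_pos h
  obtain ⟨f⟩ := h.choose_spec
  have C := (intervalSumBasis F τ h.choose).ofIso ⟨fun i => (f.equiv i).symm, fun {i j} h x => by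
    apply (f.equiv j).injective
    rw [f.comm]
    simp⟩
  have h2 : Finset.univ.val.map (fun x : h.choose.ToType => x.1) = h.choose :=
    Multiset.map_univ_coe _
  rw [h1, ← h2]
  exact le_antisymm (AdaptedBasis.map_le_of_retract C B (Hom.id V) (Hom.id V) fun _ _ => rfl)
    (AdaptedBasis.map_le_of_retract B C (Hom.id V) (Hom.id V) fun _ _ => rfl)

theorem barcode_intervalSum (D : Multiset (NonemptyInterval (Fin n))) :
    (intervalSum F τ D).barcode = D := by
  classical
  exact (intervalSumBasis F τ D).barcode_eq.trans (Multiset.map_univ_coe _)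

end ZigzagModule

/-! ### Existence of interval decompositions -/

theorem ZigzagType.Arrow.not_symm {n : ℕ} {τ : ZigzagType n} {i j : Fin n} (h : τ.Arrow i j) :
    ¬ τ.Arrow j i := by
  rintro ⟨l, hl⟩
  obtain ⟨m, hm⟩ := h
  obtain rfl : l = m := by
    apply Fin.ext
    rcases hl with hl | hl <;> rcases hm with hm | hm <;> omega
  rcases hl with ⟨_, _, hl⟩ | ⟨_, _, hl⟩ <;> rcases hm with ⟨_, _, hm⟩ | ⟨_, _, hm⟩
  · omega
  · simp [hl] at hm
  · simp [hl] at hm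
  · omega

theorem ZigzagType.Arrow.val_eq {n : ℕ} {τ : ZigzagType n} {i j : Fin n} (h : τ.Arrow i j) :
    j.val = i.val + 1 ∨ i.val = j.val + 1 := by
  obtain ⟨l, hl | hl⟩ := h <;> omega

namespace ZigzagModule

variable {F : Type u} [Field F] {n : ℕ} {τ : ZigzagType n} {V W : ZigzagModule F τ}

/-- The vector `v` at position `m` is the image of the generator under a homomorphism from the
interval module on `[b, m]` to the restriction of `V` to the positions up to `m`. -/
def VecExtends (V : ZigzagModule F τ) (b m : Fin n) (v : V.space m) : Prop :=
  ∃ s : ∀ i, V.space i, s m = v ∧ (∀ i, i ∉ Set.Icc b m → s i = 0) ∧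
    ∀ {i j} (h : τ.Arrow i j), i ∈ Set.Icc b m → j ≤ m → V.map h (s i) = s j

/-- The functional `ψ` at position `m` is the component of a homomorphism from the restriction of
`V` to the positions up to `m` to the interval module on `[b, m]`. -/
def CovExtends (V : ZigzagModule F τ) (b m : Fin n) (ψ : V.space m →ₗ[F] F) : Prop :=
  ∃ φ : ∀ i, V.space i →ₗ[F] F, φ m = ψ ∧ (∀ i, i ∉ Set.Icc b m → φ i = 0) ∧
    ∀ {i j} (h : τ.Arrow i j), i ≤ m → j ∈ Set.Icc b m → φ j ∘ₗ V.map h = φ i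

theorem VecExtends.succ {b m m' : Fin n} (hm : m'.val = m.val + 1) (hb : b ≤ m) {v : V.space m}
    (hv : V.VecExtends b m v) {w : V.space m'} (h1 : ∀ h : τ.Arrow m m', V.map h v = w)
    (h2 : ∀ h : τ.Arrow m' m, V.map h w = v) : V.VecExtends b m' w := by
  obtain ⟨s, hs, hs0, hsm⟩ := hv
  rw [Fin.le_def] at hb
  refine ⟨Function.update s m' w, Function.update_self .., ?_, ?_⟩
  · intro i hi
    simp only [Set.mem_Icc, Fin.le_def] at hi
    have : i ≠ m' := by rintro rfl; omega
    rw [Function.update_of_ne this]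
    apply hs0
    simp only [Set.mem_Icc, Fin.le_def]
    omega
  · intro i j h hi hj
    simp only [Set.mem_Icc, Fin.le_def] at hi hj hsm
    by_cases hi' : i = m'
    · subst hi'
      obtain rfl : j = m := Fin.ext (by have := h.val_eq; omega)
      rw [Function.update_self, Function.update_of_ne h.ne.symm, h2, hs]
    · have hi'' : i.val ≠ m'.val := fun e => hi' (Fin.ext e)
      rw [Function.update_of_ne hi']
      by_cases hj' : j = m'
      · subst hj'
        obtain rfl : i = m := Fin.ext (by have := h.val_eq; omega)
        rw [Function.update_self, hs, h1]
      · have hj'' : j.val ≠ m'.val := fun e => hj' (Fin.ext e)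
        rw [Function.update_of_ne hj']
        exact hsm h (by omega) (by omega)

theorem CovExtends.succ {b m m' : Fin n} (hm : m'.val = m.val + 1) (hb : b ≤ m)
    {ψ : V.space m →ₗ[F] F} (hψ : V.CovExtends b m ψ) {χ : V.space m' →ₗ[F] F}
    (h1 : ∀ h : τ.Arrow m m', χ ∘ₗ V.map h = ψ) (h2 : ∀ h : τ.Arrow m' m, ψ ∘ₗ V.map h = χ) :
    V.CovExtends b m' χ := by
  obtain ⟨φ, hφ, hφ0, hφm⟩ := hψ
  rw [Fin.le_def] at hb
  refine ⟨Function.update φ m' χ, Function.update_self .., ?_, ?_⟩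
  · intro i hi
    simp only [Set.mem_Icc, Fin.le_def] at hi
    have : i ≠ m' := by rintro rfl; omega
    rw [Function.update_of_ne this]
    apply hφ0
    simp only [Set.mem_Icc, Fin.le_def]
    omega
  · intro i j h hi hj
    simp only [Set.mem_Icc, Fin.le_def] at hi hj hφm
    by_cases hi' : i = m'
    · subst hi'
      obtain rfl : j = m := Fin.ext (by have := h.val_eq; omega)
      rw [Function.update_self, Function.update_of_ne h.ne.symm, hφ, h2]
    · have hi'' : i.val ≠ m'.val := fun e => hi' (Fin.ext e)
      rw [Function.update_of_ne hi']
      by_cases hj' : j = m'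
      · subst hj'
        obtain rfl : i = m := Fin.ext (by have := h.val_eq; omega)
        rw [Function.update_self, h1, hφ]
      · have hj'' : j.val ≠ m'.val := fun e => hj' (Fin.ext e)
        rw [Function.update_of_ne hj']
        exact hφm h (by omega) (by omega)

theorem vecExtends_self {m : Fin n} (v : V.space m)
    (hv : ∀ {j} (h : τ.Arrow m j), j ≤ m → V.map h v = 0) : V.VecExtends m m v := by
  classical
  refine ⟨Pi.single m v, Pi.single_eq_same _ _, ?_, ?_⟩
  · intro i hi
    rw [Set.Icc_self, Set.mem_singleton_iff] at hi
    exact Pi.single_eq_of_ne hi _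
  · intro i j h hi hj
    rw [Set.Icc_self, Set.mem_singleton_iff] at hi
    subst hi
    rw [Pi.single_eq_same, Pi.single_eq_of_ne h.ne.symm, hv h hj]

theorem covExtends_self {m : Fin n} (ψ : V.space m →ₗ[F] F)
    (hψ : ∀ {i} (h : τ.Arrow i m), i ≤ m → ψ ∘ₗ V.map h = 0) : V.CovExtends m m ψ := by
  classical
  refine ⟨Function.update (fun _ => 0) m ψ, Function.update_self .., ?_, ?_⟩
  · intro i hi
    rw [Set.Icc_self, Set.mem_singleton_iff] at hi
    rw [Function.update_of_ne hi]
  · intro i j h hi hj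
    rw [Set.Icc_self, Set.mem_singleton_iff] at hj
    subst hj
    rw [Function.update_self, Function.update_of_ne h.ne, hψ h hi]

/-- One step of a filtration of the space at `m` by subspaces: the quotient `B / A` belongs to an
interval `[b, m]`, in the sense that vectors of `B` and functionals vanishing on `A` extend to
homomorphisms from and to the interval module on `[b, m]`. -/
def FiltrationStep (V : ZigzagModule F τ) (m : Fin n) (A B : Submodule F (V.space m)) : Prop :=
  ∃ b ≤ m, (∀ v ∈ B, V.VecExtends b m v) ∧ ∀ ψ, A ≤ LinearMap.ker ψ → V.CovExtends b m ψ

/-- The images of the filtration at `m` under a map to the right, together with the whole space,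
form a filtration at the next position, and so do the preimages under a map to the left, together
with the zero subspace. -/
theorem exists_filtration (V : ZigzagModule F τ) (m : Fin n) :
    Relation.ReflTransGen (V.FiltrationStep m) ⊥ ⊤ := by
  obtain ⟨k, hk⟩ := m
  induction k with
  | zero =>
    refine Relation.ReflTransGen.single ⟨⟨0, hk⟩, le_rfl, fun v _ => ?_, fun ψ _ => ?_⟩
    · refine vecExtends_self v fun h hj => ?_
      exact absurd (Fin.ext (Nat.le_zero.1 hj)) h.ne.symm
    · refine covExtends_self ψ fun h hi => ?_
      exact absurd (Fin.ext (Nat.le_zero.1 hi)) h.ne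
  | succ k ih =>
    set m : Fin n := ⟨k, by omega⟩ with hm
    set m' : Fin n := ⟨k + 1, hk⟩ with hm'
    have ih : Relation.ReflTransGen (V.FiltrationStep m) ⊥ ⊤ := ih _
    have hmm : m'.val = m.val + 1 := rfl
    have hadj : ∀ {j}, τ.Arrow m' j ∨ τ.Arrow j m' → j ≤ m' → j = m := by
      rintro j h hj
      rw [Fin.le_def] at hj
      apply Fin.ext
      rcases h with h | h <;> have := h.val_eq <;> omega
    rcases τ.exists_arrow_or (i := m) (j := m') rfl with h | h
    · have h' := h.not_symm
      refine Relation.ReflTransGen.tail (b := Submodule.map (V.map h) ⊤) ?_ ?_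
      · rw [← Submodule.map_bot (V.map h)]
        refine ih.lift (Submodule.map (V.map h)) ?_
        rintro A B ⟨b, hb, hv, hc⟩
        refine ⟨b, hb.trans (Fin.le_def.2 (by omega)), ?_, ?_⟩
        · rintro _ ⟨v, hvB, rfl⟩
          exact (hv v hvB).succ hmm hb (fun _ => rfl) fun g => absurd g h'
        · intro ψ hψ
          refine (hc (ψ ∘ₗ V.map h) ?_).succ hmm hb (fun _ => rfl) fun g => absurd g h'
          intro a ha
          exact hψ (Submodule.mem_map_of_mem ha)
      · refine ⟨m', le_rfl, fun v _ => ?_, fun ψ hψ => ?_⟩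
        · refine vecExtends_self v fun g hj => ?_
          obtain rfl := hadj (Or.inl g) hj
          exact absurd g h'
        · refine covExtends_self ψ fun g hj => ?_
          obtain rfl := hadj (Or.inr g) hj
          ext a
          exact hψ (Submodule.mem_map_of_mem (Submodule.mem_top (x := a)))
    · have h' := h.not_symm
      refine Relation.ReflTransGen.head (b := Submodule.comap (V.map h) ⊥) ?_ ?_
      · refine ⟨m', le_rfl, fun v hv => ?_, fun ψ _ => ?_⟩
        · refine vecExtends_self v fun g hj => ?_
          obtain rfl := hadj (Or.inl g) hj
          exact hv
        · refine covExtends_self ψ fun g hj => ?_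
          obtain rfl := hadj (Or.inr g) hj
          exact absurd g h'
      · rw [← Submodule.comap_top (V.map h)]
        refine ih.lift (Submodule.comap (V.map h)) ?_
        rintro A B ⟨b, hb, hv, hc⟩
        refine ⟨b, hb.trans (Fin.le_def.2 (by omega)), ?_, ?_⟩
        · intro v hvB
          exact (hv _ hvB).succ hmm hb (fun g => absurd g h') fun _ => rfl
        · intro ψ hψ
          -- `ψ` factors through the composition of the structure map with the quotient by `A`.
          have hker : LinearMap.ker (A.mkQ ∘ₗ V.map h) ≤ LinearMap.ker ψ := by
            rw [LinearMap.ker_comp, Submodule.ker_mkQ]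
            exact hψ
          obtain ⟨χ, hχ⟩ := LinearMap.exists_extend
            (((LinearMap.ker (A.mkQ ∘ₗ V.map h)).liftQ ψ hker) ∘ₗ
              (A.mkQ ∘ₗ V.map h).quotKerEquivRange.symm.toLinearMap)
          have hχ' : (χ ∘ₗ A.mkQ) ∘ₗ V.map h = ψ := by
            ext a
            have := LinearMap.congr_fun hχ ⟨(A.mkQ ∘ₗ V.map h) a, ⟨a, rfl⟩⟩
            simp only [LinearMap.comp_apply, Submodule.subtype_apply, LinearEquiv.coe_coe] at this
            rw [LinearMap.comp_apply, LinearMap.comp_apply, this]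
            have e : (A.mkQ ∘ₗ V.map h).quotKerEquivRange.symm ⟨(A.mkQ ∘ₗ V.map h) a, ⟨a, rfl⟩⟩ =
                (LinearMap.ker (A.mkQ ∘ₗ V.map h)).mkQ a := by
              rw [LinearEquiv.symm_apply_eq]
              rfl
            exact (congrArg _ e).trans (Submodule.liftQ_apply _ _ _)
          refine (hc (χ ∘ₗ A.mkQ) ?_).succ hmm hb (fun g => absurd g h') fun _ => hχ'
          intro a ha
          rw [LinearMap.mem_ker, LinearMap.comp_apply, Submodule.mkQ_apply,
            (Submodule.Quotient.mk_eq_zero A).2 ha, map_zero]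

/-- A presentation of an interval module as a direct summand of `V`: the images `vec` of the
generators under a homomorphism from the interval module, and the components `cov` of a
homomorphism back. -/
structure IntervalSummand (V : ZigzagModule F τ) (I : NonemptyInterval (Fin n)) where
  vec : ∀ i, V.space i
  cov : ∀ i, V.space i →ₗ[F] F
  vec_eq_zero : ∀ {i}, i ∉ Set.Icc I.fst I.snd → vec i = 0
  cov_eq_zero : ∀ {i}, i ∉ Set.Icc I.fst I.snd → cov i = 0
  cov_vec : ∀ {i}, i ∈ Set.Icc I.fst I.snd → cov i (vec i) = 1
  map_vec : ∀ {i j} (h : τ.Arrow i j), i ∈ Set.Icc I.fst I.snd → V.map h (vec i) = vec j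
  cov_map : ∀ {i j} (h : τ.Arrow i j), j ∈ Set.Icc I.fst I.snd → cov j ∘ₗ V.map h = cov i

/-- At the last position `m` with a nonzero space, some step of the filtration is not trivial: this
gives a vector and a functional that extend to an interval summand. -/
theorem exists_intervalSummand (V : ZigzagModule F τ) (hV : ∃ i, Nontrivial (V.space i)) :
    ∃ I, Nonempty (V.IntervalSummand I) := by
  obtain ⟨m, hm, hmax⟩ := (Set.toFinite {i | Nontrivial (V.space i)}).exists_maximal hV
  have hm : Nontrivial (V.space m) := hm
  have hsub : ∀ i, m < i → Subsingleton (V.space i) := fun i hi =>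
    not_nontrivial_iff_subsingleton.1 fun h => absurd (hmax h hi.le) (not_le_of_gt hi)
  obtain ⟨A, B, ⟨b, hb, hv, hc⟩, hAB⟩ : ∃ A B, V.FiltrationStep m A B ∧ ¬ B ≤ A := by
    by_contra! hcon
    have : ∀ {A B}, Relation.ReflTransGen (V.FiltrationStep m) A B → B ≤ A := by
      intro A B h
      induction h with
      | refl => exact le_rfl
      | tail _ h ih => exact (hcon _ _ h).trans ih
    exact top_ne_bot (le_bot_iff.1 (this (V.exists_filtration m)))
  obtain ⟨v, hvB, hvA⟩ := SetLike.not_le_iff_exists.1 hAB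
  obtain ⟨ψ, hψv, hψA⟩ := Submodule.exists_le_ker_of_notMem hvA
  obtain ⟨s, hs, hs0, hsm⟩ := hv v hvB
  obtain ⟨φ, hφ, hφ0, hφm⟩ := hc ((ψ v)⁻¹ • ψ) fun a ha => by
    rw [LinearMap.mem_ker, LinearMap.smul_apply, hψA ha, smul_zero]
  have hmm : m ∈ Set.Icc b m := ⟨hb, le_rfl⟩
  refine ⟨⟨⟨b, m⟩, hb⟩, ⟨⟨s, φ, fun {i} => hs0 i, fun {i} => hφ0 i, ?_, ?_, ?_⟩⟩⟩
  · intro i hi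
    rw [τ.eq_of_mem_Icc (fun i => φ i (s i)) (fun {i j} h hi hj => ?_) hi hmm, hs, hφ]
    · simp [hψv]
    · rw [← hφm h hi.2 hj, LinearMap.comp_apply, hsm h hi hj.2]
  · intro i j h hi
    by_cases hj : j ≤ m
    · exact hsm h hi hj
    · have := hsub j (not_le.1 hj)
      exact Subsingleton.elim _ _
  · intro i j h hj
    by_cases hi : i ≤ m
    · exact hφm h hi hj
    · have := hsub i (not_le.1 hi)
      ext a
      rw [Subsingleton.elim a 0, map_zero, map_zero]

namespace IntervalSummand

variable {I : NonemptyInterval (Fin n)}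

theorem cov_map_eq_zero (S : V.IntervalSummand I) {i j : Fin n} (h : τ.Arrow i j) {a : V.space i}
    (ha : S.cov i a = 0) : S.cov j (V.map h a) = 0 := by
  by_cases hj : j ∈ Set.Icc I.fst I.snd
  · rw [← LinearMap.comp_apply, S.cov_map h hj, ha]
  · rw [S.cov_eq_zero hj, LinearMap.zero_apply]

/-- The complement of an interval summand. -/
def complement (S : V.IntervalSummand I) : ZigzagModule F τ where
  space i := LinearMap.ker (S.cov i)
  map {i j} h := (V.map h).restrict (p := LinearMap.ker (S.cov i)) (q := LinearMap.ker (S.cov j))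
    fun _ ha => S.cov_map_eq_zero h ha

/-- The inclusion of the complement. -/
def incl (S : V.IntervalSummand I) (i : Fin n) : S.complement.space i →ₗ[F] V.space i :=
  (LinearMap.ker (S.cov i)).subtype

/-- The projection onto the complement. -/
def proj (S : V.IntervalSummand I) (i : Fin n) : V.space i →ₗ[F] S.complement.space i :=
  (LinearMap.id - (S.cov i).smulRight (S.vec i)).codRestrict (LinearMap.ker (S.cov i)) fun a => by
    by_cases hi : i ∈ Set.Icc I.fst I.snd
    · simp [S.cov_vec hi]
    · simp [S.cov_eq_zero hi]

variable (S : V.IntervalSummand I)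

theorem incl_injective (i : Fin n) : Function.Injective (S.incl i) :=
  Submodule.subtype_injective _

theorem incl_proj (i : Fin n) (a : V.space i) :
    S.incl i (S.proj i a) = a - S.cov i a • S.vec i := rfl

theorem cov_incl (i : Fin n) (a : S.complement.space i) : S.cov i (S.incl i a) = 0 := a.2

theorem proj_incl (i : Fin n) (a : S.complement.space i) : S.proj i (S.incl i a) = a := by
  apply S.incl_injective
  rw [incl_proj, cov_incl, zero_smul, sub_zero]

theorem proj_vec (i : Fin n) : S.proj i (S.vec i) = 0 := by
  apply S.incl_injective
  rw [incl_proj, map_zero]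
  by_cases hi : i ∈ Set.Icc I.fst I.snd
  · rw [S.cov_vec hi, one_smul, sub_self]
  · rw [S.vec_eq_zero hi, smul_zero, sub_zero]

theorem incl_map {i j : Fin n} (h : τ.Arrow i j) (a : S.complement.space i) :
    S.incl j (S.complement.map h a) = V.map h (S.incl i a) := rfl

/-- An adapted basis of the complement is completed by the generator of the summand. -/
def adaptedBasis {X : Type} [Fintype X] {J : X → NonemptyInterval (Fin n)}
    (B : S.complement.AdaptedBasis X fun x => Set.Icc (J x).fst (J x).snd) :
    V.AdaptedBasis (Option X) fun x => Set.Icc (x.elim I J).fst (x.elim I J).snd where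
  vec x i := x.elim (S.vec i) fun x => S.incl i (B.vec x i)
  cov x i := x.elim (S.cov i) fun x => B.cov x i ∘ₗ S.proj i
  vec_eq_zero {x i} h := by
    rcases x with _ | x
    · exact S.vec_eq_zero h
    · exact (congrArg _ (B.vec_eq_zero h)).trans (map_zero _)
  cov_eq_zero {x i} h := by
    rcases x with _ | x
    · exact S.cov_eq_zero h
    · exact (congrArg (fun f => f ∘ₗ S.proj i) (B.cov_eq_zero h)).trans (LinearMap.zero_comp _)
  cov_vec_self {x i} h := by
    rcases x with _ | x
    · exact S.cov_vec h
    · exact (congrArg _ (S.proj_incl i _)).trans (B.cov_vec_self h)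
  cov_vec_of_ne {x y} i h := by
    rcases x with _ | x <;> rcases y with _ | y
    · exact absurd rfl h
    · exact S.cov_incl i _
    · exact (congrArg (B.cov x i) (S.proj_vec i)).trans (map_zero _)
    · exact (congrArg _ (S.proj_incl i _)).trans (B.cov_vec_of_ne i fun e => h (congrArg some e))
  sum_cov i a := by
    rw [Fintype.sum_option]
    simp only [Option.elim, LinearMap.comp_apply]
    simp only [← map_smul]
    rw [← map_sum, B.sum_cov, incl_proj, add_sub_cancel]
  map_vec {i j} h x hi hj := by
    rcases x with _ | x
    · exact S.map_vec h hi
    · exact (S.incl_map h _).symm.trans (congrArg _ (B.map_vec h hi hj))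
  map_vec_eq_zero {i j} h x hj := by
    rcases x with _ | x
    · by_cases hi : i ∈ Set.Icc I.fst I.snd
      · exact (S.map_vec h hi).trans (S.vec_eq_zero hj)
      · exact (congrArg _ (S.vec_eq_zero hi)).trans (map_zero _)
    · exact (S.incl_map h _).symm.trans
        ((congrArg _ (B.map_vec_eq_zero h hj)).trans (map_zero _))

theorem finrank_complement_lt :
    ∑ i, Module.finrank F (S.complement.space i) < ∑ i, Module.finrank F (V.space i) := by
  refine Finset.sum_lt_sum (fun i _ => LinearMap.finrank_le_finrank_of_injective
    (S.incl_injective i)) ⟨I.fst, Finset.mem_univ _, ?_⟩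
  have hI : I.fst ∈ Set.Icc I.fst I.snd := ⟨le_rfl, I.fst_le_snd⟩
  refine Submodule.finrank_lt (s := LinearMap.ker (S.cov I.fst)) fun h => ?_
  have h1 := S.cov_vec hI
  rw [LinearMap.ker_eq_top.1 h, LinearMap.zero_apply] at h1
  exact zero_ne_one h1

end IntervalSummand

/-- Existence of the decomposition into interval modules. -/
theorem exists_adaptedBasis (V : ZigzagModule F τ) :
    ∃ (X : Type) (_ : Fintype X) (I : X → NonemptyInterval (Fin n)),
      Nonempty (V.AdaptedBasis X fun x => Set.Icc (I x).fst (I x).snd) := by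
  induction hN : ∑ i, Module.finrank F (V.space i) using Nat.strong_induction_on generalizing V with
  | _ N ih =>
    by_cases hV : ∃ i, Nontrivial (V.space i)
    · obtain ⟨I, ⟨S⟩⟩ := V.exists_intervalSummand hV
      obtain ⟨X, _, J, ⟨B⟩⟩ := ih _ (hN ▸ S.finrank_complement_lt) S.complement rfl
      exact ⟨Option X, inferInstance, fun x => x.elim I J, ⟨S.adaptedBasis B⟩⟩
    · have : ∀ i, Subsingleton (V.space i) := fun i =>
        not_nontrivial_iff_subsingleton.1 fun h => hV ⟨i, h⟩
      exact ⟨Empty, inferInstance, fun x => x.elim, ⟨{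
        vec := fun x => x.elim
        cov := fun x => x.elim
        vec_eq_zero := fun {x} => x.elim
        cov_eq_zero := fun {x} => x.elim
        cov_vec_self := fun {x} => x.elim
        cov_vec_of_ne := fun {x} => x.elim
        sum_cov := fun _ _ => Subsingleton.elim _ _
        map_vec := fun _ x => x.elim
        map_vec_eq_zero := fun _ x => x.elim }⟩⟩

/-- An adapted basis of `V` indexed by the members of its barcode. -/
theorem exists_barcodeBasis (V : ZigzagModule F τ) :
    Nonempty (V.AdaptedBasis V.barcode.ToType fun x => Set.Icc x.1.fst x.1.snd) := by
  obtain ⟨X, _, I, ⟨B⟩⟩ := V.exists_adaptedBasis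
  obtain ⟨e, he⟩ := Multiset.exists_equiv_of_map_eq B.barcode_eq.symm
  exact ⟨B.reindex e fun x => by rw [he]⟩

end ZigzagModule

/-! ### The parts of a support around one position -/

namespace ZigzagModule

open ZigzagType

variable {F : Type u} [Field F] {n : ℕ} {τ : ZigzagType n} {V W : ZigzagModule F τ}

/-- A function that is constant along arrows in the neighbourhood of `k` whose ends lie in `S` is
constant on the part of `S` in this neighbourhood. -/
theorem eq_of_mem_nbhd {α : Type*} (τ : ZigzagType n) {k : Fin n} {S : Set (Fin n)}
    (hS : S.OrdConnected) (c : Nbhd k → α)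
    (hc : ∀ i j : Nbhd k, τ.Arrow i.1 j.1 → i.1 ∈ S → j.1 ∈ S → c i = c j)
    {i j : Nbhd k} (hi : i.1 ∈ S) (hj : j.1 ∈ S) : c i = c j := by
  by_cases hk : k ∈ S
  · have key : ∀ i : Nbhd k, i.1 ∈ S → c i = c (Nbhd.center k) := by
      intro i hi
      rcases Nat.lt_trichotomy i.1.val k.val with h | h | h
      · rcases τ.exists_arrow_or (i := i.1) (j := k) (by have := i.2; omega) with h | h
        · exact hc _ (Nbhd.center k) h hi hk
        · exact (hc (Nbhd.center k) _ h hk hi).symm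
      · exact congrArg c (Subtype.ext (Fin.ext h))
      · rcases τ.exists_arrow_or (i := k) (j := i.1) (by have := i.2; omega) with h | h
        · exact (hc (Nbhd.center k) _ h hk hi).symm
        · exact hc _ (Nbhd.center k) h hi hk
    rw [key i hi, key j hj]
  · have hne : ∀ i : Nbhd k, i.1 ∈ S → i.1.val ≠ k.val := fun i hi e => hk (Fin.ext e ▸ hi)
    have h1 := hne i hi
    have h2 := hne j hj
    have h3 : ∀ i j : Nbhd k, i.1 ∈ S → j.1 ∈ S → ¬ (i.1.val < k.val ∧ k.val < j.1.val) :=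
      fun i j hi hj h => hk (hS.out hi hj ⟨h.1.le, h.2.le⟩)
    have h4 := h3 i j hi hj
    have h5 := h3 j i hj hi
    have := i.2
    have := j.2
    congr 1
    apply Subtype.ext
    apply Fin.ext
    omega

/-- The support of an interval after a reflection at `k`, where `P` says whether the limit or
colimit at `k` is nonzero. -/
def reflectSupp (k : Fin n) (P : Prop) (S : Set (Fin n)) : Set (Fin n) :=
  {i | (i = k ∧ P) ∨ (i ≠ k ∧ i ∈ S)}

theorem self_mem_reflectSupp {k : Fin n} {P : Prop} {S : Set (Fin n)} :
    k ∈ reflectSupp k P S ↔ P := by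
  simp [reflectSupp]

theorem mem_reflectSupp_of_ne {k i : Fin n} {P : Prop} {S : Set (Fin n)} (h : i ≠ k) :
    i ∈ reflectSupp k P S ↔ i ∈ S := by
  simp [reflectSupp, h]

/-! ### Limits -/

/-- The limit at `k` of the indicator of `S` is nonzero: `S` contains `k` or one of its neighbours,
and the constant family on `S` is compatible. -/
def HasLimit (τ : ZigzagType n) (k : Fin n) (e : Dir) (S : Set (Fin n)) : Prop :=
  (∃ j : Nbhd k, j.1 ∈ S) ∧ (∀ i j : Nbhd k, τ.Arrow i.1 j.1 → j.1 ∈ S → i.1 ∈ S) ∧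
    (ZeroInto k e → k ∉ S)

/-- The space of the extroversion at `k`. -/
def extroAt (V : ZigzagModule F τ) (k : Fin n) (e : Dir) {i : Fin n} (h : i = k) :
    (V.extroversion k e).space i ≃ₗ[F] V.localLimit k e :=
  Slot.pos F _ _ _ h

/-- The spaces of the extroversion at the positions other than `k`. -/
def extroOff (V : ZigzagModule F τ) (k : Fin n) (e : Dir) {i : Fin n} (h : i ≠ k) :
    (V.extroversion k e).space i ≃ₗ[F] V.space i :=
  Slot.neg F _ _ _ h

theorem extroOff_map_at {k : Fin n} {e : Dir} {i j : Fin n} (h : (τ.putSource k).Arrow i j)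
    (hi : i = k) (hj : j ≠ k) (hjn : j.val ≤ k.val + 1 ∧ k.val ≤ j.val + 1)
    (a : (V.extroversion k e).space i) :
    V.extroOff k e hj ((V.extroversion k e).map h a) = (V.extroAt k e hi a).1 ⟨j, hjn⟩ :=
  (LinearEquiv.apply_symm_apply (V.extroOff k e hj) _).trans
    (congrArg (fun f : (V.extroversion k e).space i →ₗ[F] V.space j => f a) (dif_pos hi))

theorem extroOff_map {k : Fin n} {e : Dir} {i j : Fin n} (h : (τ.putSource k).Arrow i j)
    (hi : i ≠ k) (hj : j ≠ k) (a : (V.extroversion k e).space i) :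
    V.extroOff k e hj ((V.extroversion k e).map h a) =
      V.map (h.of_putSource hi) (V.extroOff k e hi a) :=
  (LinearEquiv.apply_symm_apply (V.extroOff k e hj) _).trans
    (congrArg (fun f : (V.extroversion k e).space i →ₗ[F] V.space j => f a) (dif_neg hi))

namespace AdaptedBasis

variable {X : Type} [Fintype X] {supp : X → Set (Fin n)}

section Limit

variable (B : V.AdaptedBasis X supp) (k : Fin n) (e : Dir)

theorem vec_mem_localLimit {x : X} (h : HasLimit τ k e (supp x)) :
    (fun j : Nbhd k => B.vec x j.1) ∈ V.localLimit k e := by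
  refine ⟨fun i j hij => ?_, fun hz => B.vec_eq_zero (h.2.2 hz)⟩
  by_cases hj : j.1 ∈ supp x
  · exact B.map_vec hij (h.2.1 i j hij hj) hj
  · exact (B.map_vec_eq_zero hij hj).trans (B.vec_eq_zero hj).symm

open Classical in
/-- The vectors of an adapted basis that form a compatible family around `k`. -/
noncomputable def limitVec (x : X) : V.localLimit k e :=
  if h : HasLimit τ k e (supp x) then ⟨_, B.vec_mem_localLimit k e h⟩ else 0

open Classical in
/-- The coordinate of a compatible family, read off at any position in the support. -/
noncomputable def limitCov (x : X) : V.localLimit k e →ₗ[F] F :=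
  if h : HasLimit τ k e (supp x) then
    B.cov x h.1.choose.1 ∘ₗ LinearMap.proj (φ := fun j : Nbhd k => V.space j.1) h.1.choose ∘ₗ
      (V.localLimit k e).subtype
  else 0

variable {B k e}

theorem limitVec_apply {x : X} (h : HasLimit τ k e (supp x)) (j : Nbhd k) :
    (B.limitVec k e x).1 j = B.vec x j.1 := by
  rw [limitVec, dif_pos h]

theorem limitVec_eq_zero {x : X} (h : ¬ HasLimit τ k e (supp x)) : B.limitVec k e x = 0 :=
  dif_neg h

theorem limitCov_eq_zero {x : X} (h : ¬ HasLimit τ k e (supp x)) : B.limitCov k e x = 0 :=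
  dif_neg h

/-- The coordinates of index `x` of a compatible family agree at all positions in the support, and
they vanish unless the basis vectors of index `x` form a compatible family themselves. -/
theorem cov_limit {x : X} (hS : (supp x).OrdConnected) (a : V.localLimit k e) {j : Nbhd k}
    (hj : j.1 ∈ supp x) : B.cov x j.1 (a.1 j) = B.limitCov k e x a := by
  have hconst : ∀ {i j : Nbhd k}, i.1 ∈ supp x → j.1 ∈ supp x →
      B.cov x i.1 (a.1 i) = B.cov x j.1 (a.1 j) :=
    eq_of_mem_nbhd τ hS (fun j : Nbhd k => B.cov x j.1 (a.1 j)) fun i j h hi hj => by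
      rw [← a.2.1 i j h, B.cov_map h hi hj]
  by_cases h : HasLimit τ k e (supp x)
  · rw [limitCov, dif_pos h]
    exact hconst hj h.1.choose_spec
  · rw [limitCov_eq_zero h, LinearMap.zero_apply]
    by_cases h1 : ∀ i j : Nbhd k, τ.Arrow i.1 j.1 → j.1 ∈ supp x → i.1 ∈ supp x
    · have h2 : ZeroInto k e ∧ k ∈ supp x := by
        by_contra h2
        exact h ⟨⟨j, hj⟩, h1, fun hz hk => h2 ⟨hz, hk⟩⟩
      rw [hconst (j := Nbhd.center k) hj h2.2, a.2.2 h2.1, map_zero]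
    · push Not at h1
      obtain ⟨i, i', hi, hi1, hi2⟩ := h1
      rw [hconst hj hi1, ← a.2.1 i i' hi, B.cov_map_eq_zero hi hi2]

theorem limitCov_limitVec_self {x : X} (h : HasLimit τ k e (supp x)) :
    B.limitCov k e x (B.limitVec k e x) = 1 := by
  rw [limitCov, dif_pos h]
  simp only [LinearMap.comp_apply, LinearMap.proj_apply, Submodule.subtype_apply]
  rw [limitVec_apply h]
  exact B.cov_vec_self h.1.choose_spec

theorem limitCov_limitVec_of_ne {x y : X} (hxy : x ≠ y) :
    B.limitCov k e x (B.limitVec k e y) = 0 := by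
  by_cases hy : HasLimit τ k e (supp y)
  · by_cases h : HasLimit τ k e (supp x)
    · rw [limitCov, dif_pos h]
      simp only [LinearMap.comp_apply, LinearMap.proj_apply, Submodule.subtype_apply]
      rw [limitVec_apply hy]
      exact B.cov_vec_of_ne _ hxy
    · rw [limitCov_eq_zero h, LinearMap.zero_apply]
  · rw [limitVec_eq_zero hy, map_zero]

theorem sum_limitCov (hS : ∀ x, (supp x).OrdConnected) (a : V.localLimit k e) :
    ∑ x, B.limitCov k e x a • B.limitVec k e x = a := by
  apply Subtype.ext
  funext j
  rw [AddSubmonoidClass.coe_finsetSum, Finset.sum_apply]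
  refine Eq.trans (Finset.sum_congr rfl fun x _ => ?_) (B.sum_cov j.1 (a.1 j))
  rw [Submodule.coe_smul, Pi.smul_apply]
  by_cases hj : j.1 ∈ supp x
  · by_cases h : HasLimit τ k e (supp x)
    · rw [limitVec_apply h, cov_limit (hS x) a hj]
    · rw [cov_limit (hS x) a hj, limitCov_eq_zero h, LinearMap.zero_apply, zero_smul, zero_smul]
  · rw [B.vec_eq_zero hj, smul_zero]
    by_cases h : HasLimit τ k e (supp x)
    · rw [limitVec_apply h, B.vec_eq_zero hj, smul_zero]
    · rw [limitCov_eq_zero h, LinearMap.zero_apply, zero_smul]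

variable (B k e)

/-- The adapted basis of an extroversion. -/
noncomputable def extroversion (hS : ∀ x, (supp x).OrdConnected) :
    (V.extroversion k e).AdaptedBasis X
      fun x => reflectSupp k (HasLimit τ k e (supp x)) (supp x) where
  vec x i := if h : i = k then (V.extroAt k e h).symm (B.limitVec k e x)
    else (V.extroOff k e h).symm (B.vec x i)
  cov x i := if h : i = k then B.limitCov k e x ∘ₗ (V.extroAt k e h).toLinearMap
    else B.cov x i ∘ₗ (V.extroOff k e h).toLinearMap
  vec_eq_zero {x i} hi := by
    by_cases h : i = k
    · rw [h, self_mem_reflectSupp] at hi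
      rw [dif_pos h, limitVec_eq_zero hi, map_zero]
    · rw [mem_reflectSupp_of_ne h] at hi
      rw [dif_neg h, B.vec_eq_zero hi, map_zero]
  cov_eq_zero {x i} hi := by
    by_cases h : i = k
    · rw [h, self_mem_reflectSupp] at hi
      rw [dif_pos h, limitCov_eq_zero hi, LinearMap.zero_comp]
    · rw [mem_reflectSupp_of_ne h] at hi
      rw [dif_neg h, B.cov_eq_zero hi, LinearMap.zero_comp]
  cov_vec_self {x i} hi := by
    by_cases h : i = k
    · rw [h, self_mem_reflectSupp] at hi
      rw [dif_pos h, dif_pos h]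
      simp [limitCov_limitVec_self hi]
    · rw [mem_reflectSupp_of_ne h] at hi
      rw [dif_neg h, dif_neg h]
      simp [B.cov_vec_self hi]
  cov_vec_of_ne {x y} i hxy := by
    by_cases h : i = k
    · rw [dif_pos h, dif_pos h]
      simp [limitCov_limitVec_of_ne hxy]
    · rw [dif_neg h, dif_neg h]
      simp [B.cov_vec_of_ne i hxy]
  sum_cov i a := by
    by_cases h : i = k
    · apply (V.extroAt k e h).injective
      simp only [dif_pos h, map_sum, map_smul, LinearEquiv.apply_symm_apply, LinearMap.comp_apply,
        LinearEquiv.coe_coe]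
      exact sum_limitCov hS _
    · apply (V.extroOff k e h).injective
      simp only [dif_neg h, map_sum, map_smul, LinearEquiv.apply_symm_apply, LinearMap.comp_apply,
        LinearEquiv.coe_coe]
      exact B.sum_cov i _
  map_vec {i j} h x hi hj := by
    have hjk := h.target_ne_of_putSource
    rw [mem_reflectSupp_of_ne hjk] at hj
    apply (V.extroOff k e hjk).injective
    rw [dif_neg hjk, LinearEquiv.apply_symm_apply]
    by_cases hik : i = k
    · have hx : HasLimit τ k e (supp x) := by rwa [hik, self_mem_reflectSupp] at hi
      rw [extroOff_map_at h hik hjk (hik ▸ h.target_mem), dif_pos hik,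
        LinearEquiv.apply_symm_apply, limitVec_apply hx]
    · rw [mem_reflectSupp_of_ne hik] at hi
      rw [extroOff_map h hik hjk, dif_neg hik, LinearEquiv.apply_symm_apply, B.map_vec _ hi hj]
  map_vec_eq_zero {i j} h x hj := by
    have hjk := h.target_ne_of_putSource
    rw [mem_reflectSupp_of_ne hjk] at hj
    apply (V.extroOff k e hjk).injective
    rw [map_zero]
    by_cases hik : i = k
    · rw [extroOff_map_at h hik hjk (hik ▸ h.target_mem), dif_pos hik,
        LinearEquiv.apply_symm_apply]
      by_cases hx : HasLimit τ k e (supp x)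
      · rw [limitVec_apply hx]
        exact B.vec_eq_zero hj
      · rw [limitVec_eq_zero hx]
        rfl
    · rw [extroOff_map h hik hjk, dif_neg hik, LinearEquiv.apply_symm_apply,
        B.map_vec_eq_zero _ hj]

end Limit

end AdaptedBasis

/-! ### Colimits -/

/-- The colimit at `k` of the indicator of `S` is nonzero: `S` contains `k` or one of its
neighbours, and the indicator of `S` is compatible with the relations. -/
def HasColimit (τ : ZigzagType n) (k : Fin n) (e : Dir) (S : Set (Fin n)) : Prop :=
  (∃ j : Nbhd k, j.1 ∈ S) ∧ (∀ i j : Nbhd k, τ.Arrow i.1 j.1 → i.1 ∈ S → j.1 ∈ S) ∧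
    (ZeroOutOf k e → k ∉ S)

/-- The canonical maps to the colimit. -/
def toColimit (V : ZigzagModule F τ) (k : Fin n) (e : Dir) (j : Nbhd k) :
    V.space j.1 →ₗ[F] V.localColimit k e :=
  (V.localRelations k e).mkQ ∘ₗ LinearMap.single F (fun j : Nbhd k => V.space j.1) j

theorem toColimit_map {k : Fin n} {e : Dir} {i j : Nbhd k} (h : τ.Arrow i.1 j.1)
    (a : V.space i.1) : V.toColimit k e j (V.map h a) = V.toColimit k e i a :=
  ((Submodule.Quotient.eq (V.localRelations k e)).2
    (Submodule.subset_span (Or.inl ⟨i, j, h, a, rfl⟩))).symm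

theorem toColimit_center {k : Fin n} {e : Dir} (hz : ZeroOutOf k e) (a : V.space k) :
    V.toColimit k e (Nbhd.center k) a = 0 :=
  (Submodule.Quotient.mk_eq_zero _).2 (Submodule.subset_span (Or.inr ⟨hz, a, rfl⟩))

theorem colimit_hom_ext {M : Type*} [AddCommGroup M] [Module F M] {k : Fin n} {e : Dir}
    {f g : V.localColimit k e →ₗ[F] M}
    (h : ∀ j a, f (V.toColimit k e j a) = g (V.toColimit k e j a)) :
    f = g := by
  apply Submodule.linearMap_qext
  apply LinearMap.pi_ext'
  intro j
  ext a
  exact h j a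

/-- The space of the introversion at `k`. -/
def introAt (V : ZigzagModule F τ) (k : Fin n) (e : Dir) {i : Fin n} (h : i = k) :
    (V.introversion k e).space i ≃ₗ[F] V.localColimit k e :=
  Slot.pos F _ _ _ h

/-- The spaces of the introversion at the positions other than `k`. -/
def introOff (V : ZigzagModule F τ) (k : Fin n) (e : Dir) {i : Fin n} (h : i ≠ k) :
    (V.introversion k e).space i ≃ₗ[F] V.space i :=
  Slot.neg F _ _ _ h

theorem introAt_map {k : Fin n} {e : Dir} {i j : Fin n} (h : (τ.putSink k).Arrow i j)
    (hi : i ≠ k) (hj : j = k) (hin : i.val ≤ k.val + 1 ∧ k.val ≤ i.val + 1)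
    (a : (V.introversion k e).space i) :
    V.introAt k e hj ((V.introversion k e).map h a) =
      V.toColimit k e ⟨i, hin⟩ (V.introOff k e hi a) := by
  refine (congrArg (fun f : V.space i →ₗ[F] (V.introversion k e).space j =>
    V.introAt k e hj (f (V.introOff k e hi a))) (dif_pos hj)).trans ?_
  exact LinearEquiv.apply_symm_apply (V.introAt k e hj) _

theorem introOff_map {k : Fin n} {e : Dir} {i j : Fin n} (h : (τ.putSink k).Arrow i j)
    (hi : i ≠ k) (hj : j ≠ k) (a : (V.introversion k e).space i) :
    V.introOff k e hj ((V.introversion k e).map h a) =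
      V.map (h.of_putSink hj) (V.introOff k e hi a) := by
  refine (congrArg (fun f : V.space i →ₗ[F] (V.introversion k e).space j =>
    V.introOff k e hj (f (V.introOff k e hi a))) (dif_neg hj)).trans ?_
  exact LinearEquiv.apply_symm_apply (V.introOff k e hj) _

namespace AdaptedBasis

variable {X : Type} [Fintype X] {supp : X → Set (Fin n)}

section Colimit

variable (B : V.AdaptedBasis X supp) (k : Fin n) (e : Dir)

open Classical in
/-- The class in the colimit of the basis vectors of index `x`, if it is nonzero. -/
noncomputable def colimitVec (x : X) : V.localColimit k e :=
  if h : HasColimit τ k e (supp x) then V.toColimit k e h.1.choose (B.vec x h.1.choose.1) else 0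

/-- The sum of the coordinates of index `x` around `k`. -/
noncomputable def nbhdCov (x : X) : (∀ j : Nbhd k, V.space j.1) →ₗ[F] F :=
  ∑ j : Nbhd k, B.cov x j.1 ∘ₗ LinearMap.proj (φ := fun j : Nbhd k => V.space j.1) j

theorem nbhdCov_single (x : X) (j : Nbhd k) (a : V.space j.1) :
    B.nbhdCov k x (Pi.single j a) = B.cov x j.1 a := by
  rw [nbhdCov, LinearMap.sum_apply, Finset.sum_eq_single j]
  · simp
  · intro i _ hi
    simp [Pi.single_eq_of_ne hi]
  · simp

theorem localRelations_le_ker {x : X} (h : HasColimit τ k e (supp x)) :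
    V.localRelations k e ≤ LinearMap.ker (B.nbhdCov k x) := by
  refine Submodule.span_le.2 ?_
  rintro z (⟨i, j, hij, v, rfl⟩ | ⟨hz, v, rfl⟩)
  · rw [SetLike.mem_coe, LinearMap.mem_ker, map_sub, nbhdCov_single, nbhdCov_single, sub_eq_zero]
    by_cases hi : i.1 ∈ supp x
    · exact (B.cov_map hij hi (h.2.1 i j hij hi) v).symm
    · rw [B.cov_map_eq_zero hij hi, B.cov_eq_zero hi, LinearMap.zero_apply]
  · exact (B.nbhdCov_single k x (Nbhd.center k) v).trans
      (LinearMap.congr_fun (B.cov_eq_zero (h.2.2 hz)) v)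

open Classical in
/-- The coordinate of index `x` on the colimit. -/
noncomputable def colimitCov (x : X) : V.localColimit k e →ₗ[F] F :=
  if h : HasColimit τ k e (supp x) then
    (V.localRelations k e).liftQ (B.nbhdCov k x) (B.localRelations_le_ker k e h)
  else 0

variable {B k e}

theorem colimitVec_eq_zero {x : X} (h : ¬ HasColimit τ k e (supp x)) : B.colimitVec k e x = 0 :=
  dif_neg h

theorem colimitCov_eq_zero {x : X} (h : ¬ HasColimit τ k e (supp x)) : B.colimitCov k e x = 0 :=
  dif_neg h

theorem colimitCov_toColimit {x : X} (h : HasColimit τ k e (supp x)) (j : Nbhd k)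
    (a : V.space j.1) : B.colimitCov k e x (V.toColimit k e j a) = B.cov x j.1 a := by
  rw [colimitCov, dif_pos h]
  exact (Submodule.liftQ_apply _ _ _).trans (B.nbhdCov_single k x j a)

/-- The basis vectors of index `x` have the same class in the colimit, and this class vanishes
unless the coordinates of index `x` are compatible with the relations. -/
theorem toColimit_vec {x : X} (hS : (supp x).OrdConnected) {j : Nbhd k} (hj : j.1 ∈ supp x) :
    V.toColimit k e j (B.vec x j.1) = B.colimitVec k e x := by
  have hconst : ∀ {i j : Nbhd k}, i.1 ∈ supp x → j.1 ∈ supp x →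
      V.toColimit k e i (B.vec x i.1) = V.toColimit k e j (B.vec x j.1) :=
    eq_of_mem_nbhd τ hS (fun j : Nbhd k => V.toColimit k e j (B.vec x j.1)) fun i j h hi hj => by
      rw [← B.map_vec h hi hj, toColimit_map]
  by_cases h : HasColimit τ k e (supp x)
  · rw [colimitVec, dif_pos h]
    exact hconst hj h.1.choose_spec
  · rw [colimitVec_eq_zero h]
    by_cases h1 : ∀ i j : Nbhd k, τ.Arrow i.1 j.1 → i.1 ∈ supp x → j.1 ∈ supp x
    · have h2 : ZeroOutOf k e ∧ k ∈ supp x := by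
        by_contra h2
        exact h ⟨⟨j, hj⟩, h1, fun hz hk => h2 ⟨hz, hk⟩⟩
      rw [hconst (j := Nbhd.center k) hj h2.2]
      exact toColimit_center h2.1 _
    · push Not at h1
      obtain ⟨i, i', hi, hi1, hi2⟩ := h1
      rw [hconst hj hi1, ← toColimit_map hi, B.map_vec_eq_zero hi hi2, map_zero]

theorem colimitCov_colimitVec_self {x : X} (h : HasColimit τ k e (supp x)) :
    B.colimitCov k e x (B.colimitVec k e x) = 1 := by
  rw [colimitVec, dif_pos h, colimitCov_toColimit h]
  exact B.cov_vec_self h.1.choose_spec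

theorem colimitCov_colimitVec_of_ne {x y : X} (hxy : x ≠ y) :
    B.colimitCov k e x (B.colimitVec k e y) = 0 := by
  by_cases hy : HasColimit τ k e (supp y)
  · by_cases h : HasColimit τ k e (supp x)
    · rw [colimitVec, dif_pos hy, colimitCov_toColimit h]
      exact B.cov_vec_of_ne _ hxy
    · rw [colimitCov_eq_zero h, LinearMap.zero_apply]
  · rw [colimitVec_eq_zero hy, map_zero]

theorem sum_colimitCov (hS : ∀ x, (supp x).OrdConnected) (a : V.localColimit k e) :
    ∑ x, B.colimitCov k e x a • B.colimitVec k e x = a := by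
  suffices ∑ x, (B.colimitCov k e x).smulRight (B.colimitVec k e x) = LinearMap.id by
    simpa using LinearMap.congr_fun this a
  apply colimit_hom_ext
  intro j a
  rw [LinearMap.id_apply, LinearMap.sum_apply]
  conv_rhs => rw [← B.sum_cov j.1 a, map_sum]
  refine Finset.sum_congr rfl fun x _ => ?_
  rw [LinearMap.smulRight_apply, map_smul]
  by_cases hj : j.1 ∈ supp x
  · rw [toColimit_vec (hS x) hj]
    by_cases h : HasColimit τ k e (supp x)
    · rw [colimitCov_toColimit h]
    · rw [colimitVec_eq_zero h, smul_zero, smul_zero]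
  · rw [B.vec_eq_zero hj, map_zero, smul_zero]
    by_cases h : HasColimit τ k e (supp x)
    · rw [colimitCov_toColimit h, B.cov_eq_zero hj, LinearMap.zero_apply, zero_smul]
    · rw [colimitVec_eq_zero h, smul_zero]

variable (B k e)

/-- The adapted basis of an introversion. -/
noncomputable def introversion (hS : ∀ x, (supp x).OrdConnected) :
    (V.introversion k e).AdaptedBasis X
      fun x => reflectSupp k (HasColimit τ k e (supp x)) (supp x) where
  vec x i := if h : i = k then (V.introAt k e h).symm (B.colimitVec k e x)
    else (V.introOff k e h).symm (B.vec x i)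
  cov x i := if h : i = k then B.colimitCov k e x ∘ₗ (V.introAt k e h).toLinearMap
    else B.cov x i ∘ₗ (V.introOff k e h).toLinearMap
  vec_eq_zero {x i} hi := by
    by_cases h : i = k
    · rw [h, self_mem_reflectSupp] at hi
      rw [dif_pos h, colimitVec_eq_zero hi, map_zero]
    · rw [mem_reflectSupp_of_ne h] at hi
      rw [dif_neg h, B.vec_eq_zero hi, map_zero]
  cov_eq_zero {x i} hi := by
    by_cases h : i = k
    · rw [h, self_mem_reflectSupp] at hi
      rw [dif_pos h, colimitCov_eq_zero hi, LinearMap.zero_comp]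
    · rw [mem_reflectSupp_of_ne h] at hi
      rw [dif_neg h, B.cov_eq_zero hi, LinearMap.zero_comp]
  cov_vec_self {x i} hi := by
    by_cases h : i = k
    · rw [h, self_mem_reflectSupp] at hi
      rw [dif_pos h, dif_pos h]
      simp [colimitCov_colimitVec_self hi]
    · rw [mem_reflectSupp_of_ne h] at hi
      rw [dif_neg h, dif_neg h]
      simp [B.cov_vec_self hi]
  cov_vec_of_ne {x y} i hxy := by
    by_cases h : i = k
    · rw [dif_pos h, dif_pos h]
      simp [colimitCov_colimitVec_of_ne hxy]
    · rw [dif_neg h, dif_neg h]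
      simp [B.cov_vec_of_ne i hxy]
  sum_cov i a := by
    by_cases h : i = k
    · apply (V.introAt k e h).injective
      simp only [dif_pos h, map_sum, map_smul, LinearEquiv.apply_symm_apply, LinearMap.comp_apply,
        LinearEquiv.coe_coe]
      exact sum_colimitCov hS _
    · apply (V.introOff k e h).injective
      simp only [dif_neg h, map_sum, map_smul, LinearEquiv.apply_symm_apply, LinearMap.comp_apply,
        LinearEquiv.coe_coe]
      exact B.sum_cov i _
  map_vec {i j} h x hi hj := by
    have hik := h.source_ne_of_putSink
    rw [mem_reflectSupp_of_ne hik] at hi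
    rw [dif_neg hik]
    by_cases hjk : j = k
    · apply (V.introAt k e hjk).injective
      rw [introAt_map h hik hjk (hjk ▸ h.source_mem), LinearEquiv.apply_symm_apply, dif_pos hjk,
        LinearEquiv.apply_symm_apply]
      exact toColimit_vec (hS x) hi
    · rw [mem_reflectSupp_of_ne hjk] at hj
      apply (V.introOff k e hjk).injective
      rw [introOff_map h hik hjk, LinearEquiv.apply_symm_apply, dif_neg hjk,
        LinearEquiv.apply_symm_apply, B.map_vec _ hi hj]
  map_vec_eq_zero {i j} h x hj := by
    have hik := h.source_ne_of_putSink
    rw [dif_neg hik]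
    by_cases hjk : j = k
    · have hx : ¬ HasColimit τ k e (supp x) := by rwa [hjk, self_mem_reflectSupp] at hj
      apply (V.introAt k e hjk).injective
      rw [introAt_map h hik hjk (hjk ▸ h.source_mem), LinearEquiv.apply_symm_apply, map_zero]
      by_cases hi : i ∈ supp x
      · exact (toColimit_vec (j := ⟨i, hjk ▸ h.source_mem⟩) (hS x) hi).trans
          (colimitVec_eq_zero hx)
      · rw [B.vec_eq_zero hi, map_zero]
    · rw [mem_reflectSupp_of_ne hjk] at hj
      apply (V.introOff k e hjk).injective
      rw [introOff_map h hik hjk, LinearEquiv.apply_symm_apply, map_zero, B.map_vec_eq_zero _ hj]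

end Colimit

end AdaptedBasis

end ZigzagModule

/-! ### The action of reflections on barcodes -/

namespace ZigzagModule

open ZigzagType

variable {F : Type u} [Field F] {n : ℕ} {τ : ZigzagType n} {V W : ZigzagModule F τ}

/-- The `ℓ¹` distance between two intervals, seen as points of the plane. -/
def intervalDist (I J : NonemptyInterval (Fin n)) : ℤ :=
  |(I.fst.val : ℤ) - J.fst.val| + |(I.snd.val : ℤ) - J.snd.val|

/-- The support of an interval of positive length after a reflection is an interval again: the end
at `k` is removed, or the interval grows by `k`, or nothing happens. -/
theorem exists_reflectSupp_eq_Icc {k : Fin n} {P : Prop} {I : NonemptyInterval (Fin n)}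
    (hI : I.fst ≠ I.snd) (h1 : I.fst < k → k < I.snd → P)
    (h2 : P → k.val ≤ I.snd.val + 1 ∧ I.fst.val ≤ k.val + 1) :
    ∃ J : NonemptyInterval (Fin n),
      reflectSupp k P (Set.Icc I.fst I.snd) = Set.Icc J.fst J.snd ∧ intervalDist I J ≤ 1 := by
  obtain ⟨⟨⟨b, hb⟩, ⟨d, hd⟩⟩, hbd⟩ := I
  obtain ⟨k, hk⟩ := k
  simp only [Fin.le_def, Fin.lt_def, ne_eq, Fin.ext_iff] at hI h1 h2 hbd
  have key : ∀ (b' d' : ℕ) (hb' : b' < n) (hd' : d' < n) (hbd' : b' ≤ d'),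
      (∀ i : ℕ, ((i = k ∧ P) ∨ (i ≠ k ∧ b ≤ i ∧ i ≤ d)) ↔ b' ≤ i ∧ i ≤ d') →
      (b' = b ∧ d' ≤ d + 1 ∧ d ≤ d' + 1) ∨ (d' = d ∧ b' ≤ b + 1 ∧ b ≤ b' + 1) →
      ∃ J : NonemptyInterval (Fin n), reflectSupp ⟨k, hk⟩ P (Set.Icc ⟨b, hb⟩ ⟨d, hd⟩) =
        Set.Icc J.fst J.snd ∧ intervalDist ⟨⟨⟨b, hb⟩, ⟨d, hd⟩⟩, hbd⟩ J ≤ 1 := by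
    intro b' d' hb' hd' hbd' h h'
    refine ⟨⟨⟨⟨b', hb'⟩, ⟨d', hd'⟩⟩, hbd'⟩, ?_, ?_⟩
    · ext i
      simp only [reflectSupp, Set.mem_Icc, Set.mem_ofPred_eq, Fin.le_def, Fin.ext_iff, ne_eq]
      exact h i.val
    · rcases h' with ⟨rfl, h1, h2⟩ | ⟨rfl, h1, h2⟩
      · simp only [intervalDist, sub_self, abs_zero, zero_add]
        exact abs_le.2 ⟨by omega, by omega⟩
      · simp only [intervalDist, sub_self, abs_zero, add_zero]
        exact abs_le.2 ⟨by omega, by omega⟩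
  by_cases hP : P
  · have h2 := h2 hP
    rcases lt_or_ge k b with h | h
    · exact key k d hk hd (by omega) (by intro i; simp only [hP, and_true]; omega) (by omega)
    · rcases lt_or_ge d k with h' | h'
      · exact key b k hb hk (by omega) (by intro i; simp only [hP, and_true]; omega) (by omega)
      · exact key b d hb hd hbd (by intro i; simp only [hP, and_true]; omega) (by omega)
  · simp only [hP, imp_false, not_lt] at h1
    by_cases h : k = b
    · exact key (b + 1) d (by omega) hd (by omega)
        (by intro i; simp only [hP, and_false, false_or]; omega) (by omega)
    · by_cases h' : k = d
      · exact key b (d - 1) hb (by omega) (by omega)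
          (by intro i; simp only [hP, and_false, false_or]; omega) (by omega)
      · exact key b d hb hd hbd
          (by intro i; simp only [hP, and_false, false_or]; omega) (by omega)

theorem hasLimit_Icc_of_lt_lt (τ : ZigzagType n) {k : Fin n} (e : Dir) {b d : Fin n} (hb : b < k)
    (hd : k < d) : HasLimit τ k e (Set.Icc b d) := by
  have hN : ∀ j : Nbhd k, j.1 ∈ Set.Icc b d := fun j => by
    have := j.2
    simp only [Set.mem_Icc, Fin.le_def, Fin.lt_def] at *
    omega
  refine ⟨⟨Nbhd.center k, hN _⟩, fun i _ _ _ => hN i, fun hz => ?_⟩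
  simp only [ZeroInto, Fin.lt_def] at *
  omega

theorem hasColimit_Icc_of_lt_lt (τ : ZigzagType n) {k : Fin n} (e : Dir) {b d : Fin n} (hb : b < k)
    (hd : k < d) : HasColimit τ k e (Set.Icc b d) := by
  have hN : ∀ j : Nbhd k, j.1 ∈ Set.Icc b d := fun j => by
    have := j.2
    simp only [Set.mem_Icc, Fin.le_def, Fin.lt_def] at *
    omega
  refine ⟨⟨Nbhd.center k, hN _⟩, fun _ j _ _ => hN j, fun hz => ?_⟩
  simp only [ZeroOutOf, Fin.lt_def] at *
  omega

theorem near_of_exists_mem {k b d : Fin n} (h : ∃ j : Nbhd k, j.1 ∈ Set.Icc b d) :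
    k.val ≤ d.val + 1 ∧ b.val ≤ k.val + 1 := by
  obtain ⟨j, hj⟩ := h
  have := j.2
  simp only [Set.mem_Icc, Fin.le_def] at hj
  omega

theorem AdaptedBasis.barcode_eq_of_supp {X : Type} [Fintype X] {supp : X → Set (Fin n)}
    (B : V.AdaptedBasis X supp) {I : X → NonemptyInterval (Fin n)}
    (h : ∀ x, supp x = Set.Icc (I x).fst (I x).snd) :
    V.barcode = Finset.univ.val.map I :=
  (B.reindex (Equiv.refl X) (supp' := fun x => Set.Icc (I x).fst (I x).snd)
    fun x => (h x).symm).barcode_eq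

theorem barcode_removeSimple (V : ZigzagModule F τ) :
    V.removeSimple.barcode = V.barcode.filter fun I => I.fst ≠ I.snd :=
  barcode_intervalSum _

end ZigzagModule

section ReflectionDistance

open ZigzagModule

variable {F : Type u} [Field F] {n : ℕ}

/-- A reflection moves every interval of positive length to a nonempty interval at distance at most
`1`. -/
theorem Reflection.exists_barcode_apply (r : Reflection n) (τ : ZigzagType n) :
    ∃ g : NonemptyInterval (Fin n) → NonemptyInterval (Fin n),
      (∀ I, I.fst ≠ I.snd → intervalDist I (g I) ≤ 1) ∧
      ∀ V : ZigzagModule F τ, (∀ I ∈ V.barcode, I.fst ≠ I.snd) →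
        (r.apply ⟨τ, V⟩).2.barcode = V.barcode.map g := by
  -- `P` is `HasLimit` or `HasColimit`, according to the kind of the reflection.
  obtain ⟨k, P, h1, h2, hbasis⟩ : ∃ (k : Fin n) (P : Set (Fin n) → Prop),
      (∀ I : NonemptyInterval (Fin n), I.fst < k → k < I.snd → P (Set.Icc I.fst I.snd)) ∧
      (∀ I : NonemptyInterval (Fin n), P (Set.Icc I.fst I.snd) →
        k.val ≤ I.snd.val + 1 ∧ I.fst.val ≤ k.val + 1) ∧
      ∀ (V : ZigzagModule F τ), Nonempty ((r.apply ⟨τ, V⟩).2.AdaptedBasis V.barcode.ToType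
        fun x => reflectSupp k (P (Set.Icc x.1.fst x.1.snd)) (Set.Icc x.1.fst x.1.snd)) := by
    cases r with
    | extro k e =>
      refine ⟨k, HasLimit τ k e, fun I => hasLimit_Icc_of_lt_lt τ e,
        fun I h => near_of_exists_mem h.1, fun V => ?_⟩
      obtain ⟨B⟩ := V.exists_barcodeBasis
      exact ⟨B.extroversion k e fun x => Set.ordConnected_Icc⟩
    | intro k e =>
      refine ⟨k, HasColimit τ k e, fun I => hasColimit_Icc_of_lt_lt τ e,
        fun I h => near_of_exists_mem h.1, fun V => ?_⟩
      obtain ⟨B⟩ := V.exists_barcodeBasis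
      exact ⟨B.introversion k e fun x => Set.ordConnected_Icc⟩
  have hg : ∀ I : NonemptyInterval (Fin n), ∃ J : NonemptyInterval (Fin n), I.fst ≠ I.snd →
      reflectSupp k (P (Set.Icc I.fst I.snd)) (Set.Icc I.fst I.snd) = Set.Icc J.fst J.snd ∧
        intervalDist I J ≤ 1 := by
    intro I
    by_cases hI : I.fst = I.snd
    · exact ⟨I, fun h => absurd hI h⟩
    · obtain ⟨J, hJ⟩ := exists_reflectSupp_eq_Icc hI (h1 I) (h2 I)
      exact ⟨J, fun _ => hJ⟩
  choose g hg using hg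
  refine ⟨g, fun I hI => (hg I hI).2, fun V hV => ?_⟩
  obtain ⟨B⟩ := hbasis V
  rw [B.barcode_eq_of_supp (I := fun x => g x.1) fun x => (hg x.1 (hV x.1 (Multiset.coe_mem))).1,
    ← Multiset.map_univ V.barcode g]

namespace NMod

open Classical in
/-- A sequence of `ℓ` reflections deletes intervals of length at most `ℓ` and moves each of the
other ones by at most `ℓ`. -/
theorem exists_barcode_applySeq (R : List (Reflection n)) (V : NMod F n) :
    ∃ (p : NonemptyInterval (Fin n) → Prop)
      (f : NonemptyInterval (Fin n) → NonemptyInterval (Fin n)),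
      (applySeq R V).2.barcode = (V.2.barcode.filter p).map f ∧
      (∀ I, p I → intervalDist I (f I) ≤ R.length) ∧
      ∀ I, ¬ p I → (I.snd.val : ℤ) - I.fst.val ≤ R.length := by
  induction R generalizing V with
  | nil =>
    refine ⟨fun I => I.fst ≠ I.snd, id, ?_, ?_, ?_⟩
    · rw [Multiset.map_id]
      refine (barcode_removeSimple V.2).trans ?_
      congr
    · intro I _
      simp [intervalDist]
    · intro I hI
      simp only [ne_eq, not_not] at hI
      simp [hI]
  | cons r rs ih =>
    obtain ⟨g, hg1, hg2⟩ := r.exists_barcode_apply (F := F) V.1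
    obtain ⟨p, f, hpf, hp, hp'⟩ := ih (r.apply V.removeSimple)
    refine ⟨fun I => I.fst ≠ I.snd ∧ p (g I), f ∘ g, ?_, ?_, ?_⟩
    · have h1 : (r.apply V.removeSimple).2.barcode =
          (V.2.barcode.filter fun I => I.fst ≠ I.snd).map g := by
        have := hg2 V.2.removeSimple (by
          rw [barcode_removeSimple]
          exact fun I hI => (Multiset.mem_filter.1 hI).2)
        rw [barcode_removeSimple] at this
        exact this
      refine hpf.trans ?_
      rw [h1, Multiset.filter_map, Multiset.map_map, Multiset.filter_filter]
      congr 1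
      congr! 1
      exact and_comm
    · intro I hI
      have h1 := hg1 I hI.1
      have h2 := hp _ hI.2
      simp only [intervalDist, Function.comp_apply, List.length_cons] at *
      have h3 := abs_sub_le (I.fst.val : ℤ) (g I).fst.val (f (g I)).fst.val
      have h4 := abs_sub_le (I.snd.val : ℤ) (g I).snd.val (f (g I)).snd.val
      push_cast
      linarith
    · intro I hI
      by_cases hI' : I.fst = I.snd
      · rw [hI', sub_self]
        positivity
      · have h1 := hg1 I hI'
        have h2 := hp' (g I) fun h => hI ⟨hI', h⟩
        simp only [intervalDist, List.length_cons] at *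
        have h3 := neg_abs_le ((I.fst.val : ℤ) - (g I).fst.val)
        have h4 := le_abs_self ((I.snd.val : ℤ) - (g I).snd.val)
        push_cast
        linarith

end NMod

/-! ### Equivalence and summands -/

namespace ZigzagModule

variable {τ : ZigzagType n} {V W : ZigzagModule F τ}

/-- Reversing an arrow does not change the spaces. -/
noncomputable def reverseEquiv (V : ZigzagModule F τ) (l : Fin (n - 1)) (hl : V.IsIsoAt l)
    (i : Fin n) : (V.reverse l hl).space i ≃ₗ[F] V.space i :=
  LinearEquiv.refl F (V.space i)

theorem map_reverseEquiv_map {l : Fin (n - 1)} (hl : V.IsIsoAt l) {i j : Fin n}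
    (h : (τ.reverse l).Arrow i j) (he : ZigzagType.Ends l i j) (a : (V.reverse l hl).space i) :
    V.map ⟨l, h.of_reverse_ends he⟩ (V.reverseEquiv l hl j ((V.reverse l hl).map h a)) =
      V.reverseEquiv l hl i a := by
  have h1 : (V.reverse l hl).map h a = (LinearEquiv.ofBijective (V.map ⟨l, h.of_reverse_ends he⟩)
      (hl (h.of_reverse_ends he))).symm a :=
    congrArg (fun f : V.space i →ₗ[F] V.space j => f a) (dif_pos he)
  rw [h1]
  exact (LinearEquiv.ofBijective (V.map ⟨l, h.of_reverse_ends he⟩)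
      (hl (h.of_reverse_ends he))).apply_symm_apply a

theorem reverseEquiv_map {l : Fin (n - 1)} (hl : V.IsIsoAt l) {i j : Fin n}
    (h : (τ.reverse l).Arrow i j) (he : ¬ ZigzagType.Ends l i j) (a : (V.reverse l hl).space i) :
    V.reverseEquiv l hl j ((V.reverse l hl).map h a) =
      V.map (h.of_reverse_not_ends he) (V.reverseEquiv l hl i a) :=
  congrArg (fun f : V.space i →ₗ[F] V.space j => f a) (dif_neg he)

namespace AdaptedBasis

variable {X : Type} [Fintype X] {supp : X → Set (Fin n)}

/-- No support ends at an arrow that carries an isomorphism. -/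
theorem mem_supp_iff (B : V.AdaptedBasis X supp) {i j : Fin n} (h : τ.Arrow i j)
    (hb : Function.Bijective (V.map h)) (x : X) : i ∈ supp x ↔ j ∈ supp x := by
  constructor <;> intro hi <;> by_contra hj
  · have h1 : B.vec x i = 0 := hb.1 (by rw [B.map_vec_eq_zero h hj, map_zero])
    have h2 := B.cov_vec_self hi
    rw [h1, map_zero] at h2
    exact zero_ne_one h2
  · obtain ⟨a, ha⟩ := hb.2 (B.vec x j)
    have h2 := B.cov_vec_self hi
    rw [← ha, B.cov_map_eq_zero h hj] at h2
    exact zero_ne_one h2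

/-- An adapted basis is still adapted after the reversal of an isomorphism. -/
noncomputable def reverse (B : V.AdaptedBasis X supp) (l : Fin (n - 1)) (hl : V.IsIsoAt l) :
    (V.reverse l hl).AdaptedBasis X supp where
  vec x i := (V.reverseEquiv l hl i).symm (B.vec x i)
  cov x i := B.cov x i ∘ₗ (V.reverseEquiv l hl i).toLinearMap
  vec_eq_zero hi := by rw [B.vec_eq_zero hi, map_zero]
  cov_eq_zero hi := by rw [B.cov_eq_zero hi, LinearMap.zero_comp]
  cov_vec_self hi := by simp [B.cov_vec_self hi]
  cov_vec_of_ne i h := by simp [B.cov_vec_of_ne i h]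
  sum_cov i a := by
    apply (V.reverseEquiv l hl i).injective
    simp [B.sum_cov]
  map_vec {i j} h x hi hj := by
    apply (V.reverseEquiv l hl j).injective
    rw [LinearEquiv.apply_symm_apply]
    by_cases he : ZigzagType.Ends l i j
    · have h' := h.of_reverse_ends he
      apply (hl h').1
      rw [map_reverseEquiv_map hl h he, LinearEquiv.apply_symm_apply]
      exact (B.map_vec ⟨l, h'⟩ hj hi).symm
    · rw [reverseEquiv_map hl h he, LinearEquiv.apply_symm_apply, B.map_vec _ hi hj]
  map_vec_eq_zero {i j} h x hj := by
    apply (V.reverseEquiv l hl j).injective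
    rw [map_zero]
    by_cases he : ZigzagType.Ends l i j
    · have h' := h.of_reverse_ends he
      apply (hl h').1
      rw [map_reverseEquiv_map hl h he, LinearEquiv.apply_symm_apply, map_zero]
      exact B.vec_eq_zero fun hi => hj ((B.mem_supp_iff ⟨l, h'⟩ (hl h') x).2 hi)
    · rw [reverseEquiv_map hl h he, LinearEquiv.apply_symm_apply, B.map_vec_eq_zero _ hj]

end AdaptedBasis

theorem barcode_le_of_retract (f : Hom V W) (g : Hom W V)
    (hgf : ∀ i a, g.toFun i (f.toFun i a) = a) : V.barcode ≤ W.barcode := by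
  obtain ⟨B⟩ := V.exists_barcodeBasis
  obtain ⟨C⟩ := W.exists_barcodeBasis
  exact (Multiset.map_univ_coe V.barcode).symm.trans_le
    ((AdaptedBasis.map_le_of_retract B C f g hgf).trans_eq (Multiset.map_univ_coe W.barcode))

/-- The inclusion of the first summand. -/
def Hom.inl (V W : ZigzagModule F τ) : Hom V (directSum V W) where
  toFun i := LinearMap.inl F (V.space i) (W.space i)
  comm h _ := Prod.ext rfl (map_zero (W.map h)).symm

/-- The projection to the first summand. -/
def Hom.fst (V W : ZigzagModule F τ) : Hom (directSum V W) V where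
  toFun i := LinearMap.fst F (V.space i) (W.space i)
  comm _ _ := rfl

theorem Hom.fst_inl (i : Fin n) (a : V.space i) :
    (Hom.fst V W).toFun i ((Hom.inl V W).toFun i a) = a := rfl

theorem Iso.symm_comm (f : Iso V W) {i j : Fin n} (h : τ.Arrow i j) (x : W.space i) :
    (f.equiv j).symm (W.map h x) = V.map h ((f.equiv i).symm x) := by
  rw [LinearEquiv.symm_apply_eq, f.comm, LinearEquiv.apply_symm_apply]

theorem IsSummand.barcode_le (h : IsSummand W V) : W.barcode ≤ V.barcode := by
  obtain ⟨U, ⟨f⟩⟩ := h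
  refine barcode_le_of_retract
    ⟨fun i => (f.equiv i).symm.toLinearMap ∘ₗ (Hom.inl W U).toFun i, fun {i j} h x => ?_⟩
    ⟨fun i => (Hom.fst W U).toFun i ∘ₗ (f.equiv i).toLinearMap, fun {i j} h x => ?_⟩ ?_
  · simp only [LinearMap.comp_apply, LinearEquiv.coe_coe]
    rw [(Hom.inl W U).comm, f.symm_comm]
  · simp only [LinearMap.comp_apply, LinearEquiv.coe_coe]
    rw [f.comm, (Hom.fst W U).comm]
  · intro i a
    simp only [LinearMap.comp_apply, LinearEquiv.coe_coe, LinearEquiv.apply_symm_apply]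
    exact Hom.fst_inl i a

end ZigzagModule

namespace NMod

theorem Sim.barcode_eq {V W : NMod F n} (h : Sim V W) : V.2.barcode = W.2.barcode := by
  induction h with
  | @of_iso τ V W h =>
    obtain ⟨f⟩ := h
    obtain ⟨B⟩ := V.exists_barcodeBasis
    exact ((B.ofIso f).barcode_eq.trans (Multiset.map_univ_coe _)).symm
  | @reverse τ V W l hl h ih =>
    rw [← ih]
    obtain ⟨B⟩ := V.exists_barcodeBasis
    exact ((B.reverse l hl).barcode_eq.trans (Multiset.map_univ_coe _)).symm

theorem Precsim.barcode_le {V W : NMod F n} (h : Precsim W V) : W.2.barcode ≤ V.2.barcode := by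
  obtain ⟨W', h1, h2⟩ := h
  rw [h1.barcode_eq]
  exact h2.barcode_le

end NMod

/-! ### Reduction of a module to zero -/

namespace ZigzagModule

variable {τ : ZigzagType n} {V : ZigzagModule F τ}

/-- Every space of the module vanishes. -/
def IsZero (V : ZigzagModule F τ) : Prop := ∀ i, Subsingleton (V.space i)

theorem removeSimple_subsingleton {i : Fin n} (h : Subsingleton (V.space i)) :
    Subsingleton (V.removeSimple.space i) := by
  obtain ⟨B⟩ := V.exists_barcodeBasis
  have hmem : ∀ I ∈ V.barcode, i ∉ Set.Icc I.fst I.snd := by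
    intro I hI hi
    obtain ⟨x, rfl⟩ : ∃ x : V.barcode.ToType, x.1 = I :=
      ⟨⟨I, ⟨0, Multiset.count_pos.2 hI⟩⟩, rfl⟩
    have h1 := B.cov_vec_self (x := x) hi
    rw [Subsingleton.elim (B.vec x i) 0, map_zero] at h1
    exact zero_ne_one h1
  let C := intervalSumBasis F τ (V.barcode.filter fun I => I.fst ≠ I.snd)
  refine ⟨fun a b => C.ext_cov fun x => ?_⟩
  rw [C.cov_eq_zero (hmem x.1 (Multiset.mem_filter.1 Multiset.coe_mem).1)]
  rfl

theorem removeSimple_isZero (h : V.IsZero) : V.removeSimple.IsZero := fun i =>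
  removeSimple_subsingleton (h i)

theorem IsZero.isIsoAt (h : V.IsZero) (l : Fin (n - 1)) : V.IsIsoAt l := fun {i j} _ =>
  ⟨fun _ _ _ => (h i).elim _ _, fun _ => ⟨0, (h j).elim _ _⟩⟩

theorem IsZero.reverse (h : V.IsZero) (l : Fin (n - 1)) :
    (V.reverse l (h.isIsoAt l)).IsZero := h

theorem IsZero.isSummand {W : ZigzagModule F τ} (h : W.IsZero) : IsSummand W V := by
  refine ⟨V, ⟨⟨fun i => LinearEquiv.ofLinearMap (LinearMap.inr F (W.space i) (V.space i))
    (LinearMap.snd F (W.space i) (V.space i)) ?_ ?_, ?_⟩⟩⟩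
  · exact LinearMap.ext fun a => Prod.ext ((h i).elim _ _) rfl
  · exact LinearMap.ext fun a => rfl
  · intro i j _ x
    exact Prod.ext ((h j).elim _ _) rfl

end ZigzagModule

namespace NMod

/-- All arrows of a zero module may be reversed. -/
theorem exists_sim_of_isZero (τ' : ZigzagType n) {τ : ZigzagType n} (V : ZigzagModule F τ)
    (h : V.IsZero) : ∃ W : ZigzagModule F τ', W.IsZero ∧ Sim ⟨τ, V⟩ ⟨τ', W⟩ := by
  induction hN : (Finset.univ.filter fun l => τ l ≠ τ' l).card using Nat.strong_induction_on
    generalizing τ with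
  | _ N ih =>
    by_cases hτ : τ = τ'
    · subst hτ
      exact ⟨V, h, Sim.of_iso ⟨⟨fun _ => LinearEquiv.refl F _, fun _ _ => rfl⟩⟩⟩
    · obtain ⟨l, hl⟩ := Function.ne_iff.1 hτ
      have hflip : (τ l).flip = τ' l := by
        cases h1 : τ l <;> cases h2 : τ' l <;> simp_all [Dir.flip]
      have hcard : (Finset.univ.filter fun m => τ.reverse l m ≠ τ' m).card < N := by
        rw [← hN]
        refine Finset.card_lt_card ((Finset.ssubset_iff_of_subset fun m hm => ?_).2
          ⟨l, by simpa using hl, by simp [ZigzagType.reverse, hflip]⟩)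
        by_cases hml : m = l
        · subst hml
          simpa using hl
        · have h2 := (Finset.mem_filter.1 hm).2
          rw [ZigzagType.reverse, Function.update_of_ne hml] at h2
          exact Finset.mem_filter.2 ⟨Finset.mem_univ _, h2⟩
      obtain ⟨W, hW, hs⟩ := ih _ hcard (V.reverse l (h.isIsoAt l)) (h.reverse l) rfl
      exact ⟨W, hW, Sim.reverse l (h.isIsoAt l) hs⟩

theorem precsim_of_isZero {V W : NMod F n} (h : V.2.IsZero) : Precsim V W := by
  obtain ⟨W', hW', hs⟩ := exists_sim_of_isZero W.1 V.2 h
  exact ⟨W', hs, hW'.isSummand⟩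

end NMod

namespace ZigzagModule

variable {τ : ZigzagType n} {V : ZigzagModule F τ}

/-- If the zigzag ends with `Vₖ₋₁ ← Vₖ ← 0 ⋯ 0`, then the extroversion at `k` vanishes at `k`. -/
theorem extroversion_subsingleton {k : Fin n} (hV : ∀ j, k < j → Subsingleton (V.space j))
    (hτ : ∀ l : Fin (n - 1), l.val ≤ k.val → τ l = Dir.left) :
    Subsingleton ((V.extroversion k Dir.left).space k) := by
  have hcenter : ∀ a : V.localLimit k Dir.left, a.1 (ZigzagType.Nbhd.center k) = 0 := by
    intro a
    by_cases hk : k.val + 1 = n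
    · exact a.2.2 (Or.inr ⟨hk, rfl⟩)
    · let j : ZigzagType.Nbhd k := ⟨⟨k.val + 1, by omega⟩, by simp, by simp only; omega⟩
      have hj : τ.Arrow j.1 k :=
        ⟨⟨k.val, by omega⟩, Or.inr ⟨rfl, rfl, hτ _ le_rfl⟩⟩
      have := hV j.1 (Fin.lt_def.2 (Nat.lt_succ_self _))
      rw [← a.2.1 j (ZigzagType.Nbhd.center k) hj, Subsingleton.elim (a.1 j) 0, map_zero]
  have hzero : ∀ a : V.localLimit k Dir.left, a = 0 := by
    intro a
    apply Subtype.ext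
    funext j
    change a.1 j = 0
    rcases lt_trichotomy j.1 k with h | h | h
    · have hjk : j.1.val + 1 = k.val := by
        have := j.2
        rw [Fin.lt_def] at h
        omega
      have hj : τ.Arrow k j.1 :=
        ⟨⟨j.1.val, by omega⟩, Or.inr ⟨rfl, hjk.symm, hτ _ (by simp only; omega)⟩⟩
      rw [← a.2.1 (ZigzagType.Nbhd.center k) j hj, hcenter, map_zero]
    · obtain rfl : j = ZigzagType.Nbhd.center k := Subtype.ext h
      exact hcenter a
    · have := hV j.1 h
      exact Subsingleton.elim _ _
  have : Subsingleton (V.localLimit k Dir.left) := ⟨fun a b => by rw [hzero a, hzero b]⟩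
  exact (V.extroAt k Dir.left rfl).toEquiv.subsingleton

end ZigzagModule

namespace NMod

/-- If all arrows point to the left, then extroversions from right to left kill the module, one
position after the other; `m` is the number of positions still to be treated. -/
theorem exists_applySeq_isZero_of_left (m : ℕ) (hm : m ≤ n) (V : NMod F n)
    (hV : ∀ j : Fin n, m ≤ j.val → Subsingleton (V.2.space j))
    (hτ : ∀ l : Fin (n - 1), l.val + 1 ≤ m → V.1 l = Dir.left) :
    ∃ R : List (Reflection n), (applySeq R V).2.IsZero := by
  induction m generalizing V with
  | zero => exact ⟨[], removeSimple_isZero fun j => hV j (Nat.zero_le _)⟩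
  | succ m ih =>
    let k : Fin n := ⟨m, hm⟩
    suffices ∃ R, (applySeq R ((Reflection.extro k Dir.left).apply V.removeSimple)).2.IsZero by
      obtain ⟨R, hR⟩ := this
      exact ⟨Reflection.extro k Dir.left :: R, hR⟩
    refine ih (by omega) _ ?_ ?_
    · have h1 : ∀ j : Fin n, k < j → Subsingleton (V.2.removeSimple.space j) := fun j hj =>
        removeSimple_subsingleton (hV j hj)
      intro j hj
      by_cases hjk : j = k
      · subst hjk
        exact extroversion_subsingleton h1 fun l hl => hτ l (Nat.succ_le_succ hl)
      · have := h1 j (lt_of_le_of_ne hj (Ne.symm hjk))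
        exact (V.2.removeSimple.extroOff k Dir.left hjk).toEquiv.subsingleton
    · intro l hl
      have h1 : l.val ≠ k.val := by simp only [k]; omega
      refine (if_neg h1).trans ?_
      by_cases h2 : l.val + 1 = k.val
      · exact if_pos h2
      · exact (if_neg h2).trans (hτ l (by omega))

/-- Extroversions from left to right make all arrows point to the left: the one at `k` turns the
arrow between `k - 1` and `k`, which is then not touched by those further to the right. -/
theorem exists_applySeq_isZero_of_left_lt (k : ℕ) (hk : k ≤ n) (V : NMod F n)
    (hτ : ∀ l : Fin (n - 1), l.val + 1 < k → V.1 l = Dir.left) :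
    ∃ R : List (Reflection n), (applySeq R V).2.IsZero := by
  induction hN : n - k generalizing k V with
  | zero =>
    exact exists_applySeq_isZero_of_left n le_rfl V (fun j hj => absurd j.2 (not_lt.2 hj))
      fun l _ => hτ l (by omega)
  | succ N ih =>
    let k' : Fin n := ⟨k, by omega⟩
    suffices ∃ R, (applySeq R ((Reflection.extro k' Dir.left).apply V.removeSimple)).2.IsZero by
      obtain ⟨R, hR⟩ := this
      exact ⟨Reflection.extro k' Dir.left :: R, hR⟩
    refine ih (k + 1) (by omega) _ (fun l hl => ?_) (by omega)
    have h1 : l.val ≠ k'.val := by simp only [k']; omega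
    refine (if_neg h1).trans ?_
    by_cases h2 : l.val + 1 = k'.val
    · exact if_pos h2
    · exact (if_neg h2).trans (hτ l (by simp only [k'] at h2; omega))

theorem exists_applySeq_precsim (V W : NMod F n) :
    ∃ R : List (Reflection n), Precsim (applySeq R V) W := by
  obtain ⟨R, hR⟩ := exists_applySeq_isZero_of_left_lt 0 (Nat.zero_le n) V
    fun l hl => absurd hl (Nat.not_lt_zero _)
  exact ⟨R, precsim_of_isZero hR⟩

end NMod

/-! ### Matchings -/

/-- A relation that is functional in both directions is a partial bijection. -/
theorem PEquiv.exists_of_biUnique {α β : Type*} {r : α → β → Prop} (hr : Relator.BiUnique r) :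
    ∃ M : α ≃. β, ∀ x y, y ∈ M x ↔ r x y := by
  classical
  have h1 : ∀ x y, y ∈ (if h : ∃ y, r x y then some h.choose else none) ↔ r x y := by
    intro x y
    by_cases h : ∃ y, r x y
    · rw [dif_pos h, Option.mem_some_iff]
      exact ⟨fun e => e ▸ h.choose_spec, fun hy => hr.2 h.choose_spec hy⟩
    · rw [dif_neg h]
      exact ⟨fun e => by simp at e, fun hy => absurd ⟨y, hy⟩ h⟩
  have h2 : ∀ x y, x ∈ (if h : ∃ x, r x y then some h.choose else none) ↔ r x y := by
    intro x y
    by_cases h : ∃ x, r x y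
    · rw [dif_pos h, Option.mem_some_iff]
      exact ⟨fun e => e ▸ h.choose_spec, fun hy => hr.1 h.choose_spec hy⟩
    · rw [dif_neg h]
      exact ⟨fun e => by simp at e, fun hy => absurd ⟨x, hy⟩ h⟩
  exact ⟨⟨fun x => if h : ∃ y, r x y then some h.choose else none,
    fun y => if h : ∃ x, r x y then some h.choose else none,
    fun x y => (h2 x y).trans (h1 x y).symm⟩, h1⟩

/-- A version of the Cantor–Schröder–Bernstein theorem for partial maps: injections `f` from a part
of `α` and `g` from a part of `β` combine to a partial bijection that is defined on both parts and
agrees with `f` or with the inverse of `g` at each pair. -/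
theorem PEquiv.exists_of_injective {α β : Type*} {p : α → Prop} {q : β → Prop}
    {f : {x // p x} → β} {g : {y // q y} → α} (hf : Function.Injective f)
    (hg : Function.Injective g) :
    ∃ M : α ≃. β,
      (∀ x y, y ∈ M x → (∃ h, f ⟨x, h⟩ = y) ∨ ∃ h, g ⟨y, h⟩ = x) ∧
      (∀ x, p x → ∃ y, y ∈ M x) ∧ ∀ y, q y → ∃ x, y ∈ M x := by
  -- `A` is the part of `α` matched by `f`: the points not in the image of `g`, and those that are
  -- the image of a point already matched by `f`.
  let Φ : Set α →o Set α :=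
    ⟨fun A => {x | p x ∧ ∀ y (h : q y), g ⟨y, h⟩ = x → ∃ x' ∈ A, ∃ h', f ⟨x', h'⟩ = y},
      fun A A' hA x hx => ⟨hx.1, fun y h e => by
        obtain ⟨x', hx', h'⟩ := hx.2 y h e
        exact ⟨x', hA hx', h'⟩⟩⟩
  obtain ⟨A, hA⟩ : ∃ A : Set α, ∀ x, x ∈ A ↔
      p x ∧ ∀ y (h : q y), g ⟨y, h⟩ = x → ∃ x' ∈ A, ∃ h', f ⟨x', h'⟩ = y :=
    ⟨Φ.lfp, fun x => Set.ext_iff.1 Φ.map_lfp.symm x⟩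
  let r : α → β → Prop := fun x y => (x ∈ A ∧ ∃ h, f ⟨x, h⟩ = y) ∨
    ((∀ x' ∈ A, ∀ h, f ⟨x', h⟩ ≠ y) ∧ ∃ h, g ⟨y, h⟩ = x)
  have hr : Relator.BiUnique r := by
    constructor
    · rintro x x' y (⟨hx, h, hy⟩ | ⟨hx, h, hy⟩) (⟨hx', h', hy'⟩ | ⟨hx', h', hy'⟩)
      · exact congrArg Subtype.val (hf (hy.trans hy'.symm))
      · exact absurd hy (hx' x hx h)
      · exact absurd hy' (hx x' hx' h')
      · exact hy.symm.trans hy'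
    · rintro x y y' (⟨hx, h, hy⟩ | ⟨hx, h, hy⟩) (⟨hx', h', hy'⟩ | ⟨hx', h', hy'⟩)
      · exact hy.symm.trans hy'
      · obtain ⟨x', hA', h2, h3⟩ := ((hA x).1 hx).2 y' h' hy'
        exact absurd h3 (hx' x' hA' h2)
      · obtain ⟨x', hA', h2, h3⟩ := ((hA x).1 hx').2 y h hy
        exact absurd h3 (hx x' hA' h2)
      · exact congrArg Subtype.val (hg (hy.trans hy'.symm))
  obtain ⟨M, hM⟩ := PEquiv.exists_of_biUnique hr
  refine ⟨M, fun x y hxy => ?_, fun x hx => ?_, fun y hy => ?_⟩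
  · rcases (hM x y).1 hxy with ⟨_, h⟩ | ⟨_, h⟩
    · exact Or.inl h
    · exact Or.inr h
  · by_cases hxA : x ∈ A
    · exact ⟨_, (hM _ _).2 (Or.inl ⟨hxA, hx, rfl⟩)⟩
    · by_contra hno
      refine hxA ((hA x).2 ⟨hx, fun y h e => ?_⟩)
      by_contra h2
      push Not at h2
      exact hno ⟨y, (hM _ _).2 (Or.inr ⟨h2, h, e⟩)⟩
  · by_cases hyA : ∃ x' ∈ A, ∃ h, f ⟨x', h⟩ = y
    · obtain ⟨x', hx', h⟩ := hyA
      exact ⟨x', (hM _ _).2 (Or.inl ⟨hx', h⟩)⟩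
    · push Not at hyA
      exact ⟨_, (hM _ _).2 (Or.inr ⟨hyA, hy, rfl⟩)⟩

namespace Bottleneck

theorem cost_nonneg {S T : Multiset (ℝ × ℝ)} (M : S.ToType ≃. T.ToType) : 0 ≤ cost 1 M := by
  refine Real.sSup_nonneg ?_
  rintro c ((⟨s, t, _, rfl⟩ | ⟨s, _, rfl⟩) | ⟨t, _, rfl⟩)
  · exact norm_nonneg _
  · exact div_nonneg (abs_nonneg _) (by positivity)
  · exact div_nonneg (abs_nonneg _) (by positivity)

theorem unmatchedCost_one (r : ℝ × ℝ) : unmatchedCost 1 r = |r.2 - r.1| := by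
  simp [unmatchedCost]

theorem norm_one (r : ℝ × ℝ) : ‖WithLp.toLp 1 r‖ = |r.1| + |r.2| :=
  WithLp.prod_norm_eq_of_L1 _

/-- To bound the distance between two diagrams given by indexed points, it suffices to give a
matching of the index sets. -/
theorem dist_map_le {α β : Type*} [DecidableEq α] [DecidableEq β] {D : Multiset α} {E : Multiset β}
    {a : α → ℝ × ℝ} {b : β → ℝ × ℝ} {c : ℝ} (hc : 0 ≤ c) (M : D.ToType ≃. E.ToType)
    (h1 : ∀ x y, y ∈ M x → |(a x.1).1 - (b y.1).1| + |(a x.1).2 - (b y.1).2| ≤ c)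
    (h2 : ∀ x, (∀ y, y ∉ M x) → |(a x.1).2 - (a x.1).1| ≤ c)
    (h3 : ∀ y, (∀ x, y ∉ M x) → |(b y.1).2 - (b y.1).1| ≤ c) :
    dist 1 (D.map a) (E.map b) ≤ c := by
  let eD := D.mapEquiv a
  let eE := E.mapEquiv b
  have hD : ∀ x, (eD x).1 = a x.1 := D.mapEquiv_apply a
  have hE : ∀ y, (eE y).1 = b y.1 := E.mapEquiv_apply b
  let M' : (D.map a).ToType ≃. (E.map b).ToType :=
    (eD.symm.toPEquiv.trans M).trans eE.toPEquiv
  have hM' : ∀ x y, eE y ∈ M' (eD x) ↔ y ∈ M x := by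
    intro x y
    simp only [M', PEquiv.trans, Equiv.toPEquiv]
    rcases hx : M x with _ | y' <;> simp [hx]
  refine (ciInf_le ⟨0, ?_⟩ M').trans (Real.sSup_le ?_ hc)
  · rintro _ ⟨M, rfl⟩
    exact cost_nonneg M
  · rintro _ ((⟨s, t, hst, rfl⟩ | ⟨s, hs, rfl⟩) | ⟨t, ht, rfl⟩)
    · obtain ⟨x, rfl⟩ := eD.surjective s
      obtain ⟨y, rfl⟩ := eE.surjective t
      rw [norm_one, hD, hE]
      exact h1 x y ((hM' x y).1 hst)
    · obtain ⟨x, rfl⟩ := eD.surjective s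
      rw [unmatchedCost_one, hD]
      refine h2 x fun y hy => ?_
      have := (hM' x y).2 hy
      rw [hs] at this
      simp at this
    · obtain ⟨y, rfl⟩ := eE.surjective t
      rw [unmatchedCost_one, hE]
      refine h3 y fun x hx => ?_
      have := (PEquiv.mem_iff_mem M').2 ((hM' x y).2 hx)
      rw [ht] at this
      simp at this

end Bottleneck

namespace NMod

theorem cost_one (R : List (Reflection n)) : cost 1 R = R.length := by
  unfold cost
  split_ifs with h
  · simp [h]
  · simp

/-- If a sequence of `ℓ` reflections takes `V` to a module equivalent to a summand of `W`, then the
intervals of `V`, except some of length at most `ℓ`, can be matched injectively with intervals of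
`W` at distance at most `ℓ`. -/
theorem exists_injective_of_precsim {R : List (Reflection n)} {V W : NMod F n}
    (h : Precsim (applySeq R V) W) :
    ∃ (p : V.2.barcode.ToType → Prop) (f : {x // p x} → W.2.barcode.ToType),
      Function.Injective f ∧ (∀ x, intervalDist x.1.1 (f x).1 ≤ R.length) ∧
      ∀ x, ¬ p x → (x.1.snd.val : ℤ) - x.1.fst.val ≤ R.length := by
  classical
  obtain ⟨p, f, hpf, hp, hp'⟩ := exists_barcode_applySeq R V
  have hle := h.barcode_le
  rw [hpf] at hle
  have hmap : Finset.univ.val.map (fun x : {x : V.2.barcode.ToType // p x.1} => f x.1.1) ≤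
      W.2.barcode := by
    refine le_of_eq_of_le ?_ hle
    have h1 : (Finset.univ.filter fun x : V.2.barcode.ToType => p x.1) =
        (Finset.univ : Finset {x : V.2.barcode.ToType // p x.1}).map
          (Function.Embedding.subtype _) := by
      rw [← Finset.subtype_map, Finset.subtype_univ]
    have h2 := congrArg (fun s => s.val.map fun x => f x.1) h1
    simp only [Finset.map_val, Multiset.map_map, Finset.filter_val] at h2
    refine Eq.trans h2.symm ?_
    conv_rhs => rw [← Multiset.map_univ_coe V.2.barcode, Multiset.filter_map, Multiset.map_map]
    rfl
  obtain ⟨j, hj, hj'⟩ := Multiset.exists_injective_of_map_le hmap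
  exact ⟨fun x => p x.1, j, hj, fun x => by rw [hj' x]; exact hp _ x.2, fun x hx => hp' _ hx⟩

theorem dist_le_of_precsim {R R' : List (Reflection n)} {V W : NMod F n}
    (h : Precsim (applySeq R V) W) (h' : Precsim (applySeq R' W) V) :
    Bottleneck.dist 1 V.diagram W.diagram ≤ max (cost 1 R) (cost 1 R') := by
  obtain ⟨p, f, hf, hfd, hp⟩ := exists_injective_of_precsim h
  obtain ⟨q, g, hg, hgd, hq⟩ := exists_injective_of_precsim h'
  obtain ⟨M, hM, hMp, hMq⟩ := PEquiv.exists_of_injective hf hg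
  rw [cost_one, cost_one]
  have hlen : ∀ I : NonemptyInterval (Fin n), ∀ ℓ : ℕ, (I.snd.val : ℤ) - I.fst.val ≤ ℓ →
      |((I.snd.val : ℝ) + 1) - ((I.fst.val : ℝ) + 1)| ≤ ℓ := by
    intro I ℓ h
    have h1 : (I.fst.val : ℝ) ≤ I.snd.val := by exact_mod_cast I.fst_le_snd
    have h2 : (I.snd.val : ℝ) - I.fst.val ≤ ℓ := by exact_mod_cast h
    rw [add_sub_add_right_eq_sub, abs_of_nonneg (sub_nonneg.2 h1)]
    exact h2
  refine Bottleneck.dist_map_le (by positivity) M (fun x y hxy => ?_) (fun x hx => ?_)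
    fun y hy => ?_
  · have hd : intervalDist x.1 y.1 ≤ (max R.length R'.length : ℕ) := by
      rcases hM x y hxy with ⟨hx, rfl⟩ | ⟨hy, rfl⟩
      · exact (hfd ⟨x, hx⟩).trans (by simp)
      · refine le_trans ?_ ((hgd ⟨y, hy⟩).trans (by simp))
        simp only [intervalDist]
        rw [abs_sub_comm, abs_sub_comm (_ : ℤ) (y.1.snd.val : ℤ)]
    have hd' : ((intervalDist x.1 y.1 : ℤ) : ℝ) ≤ ((max R.length R'.length : ℕ) : ℝ) := by
      exact_mod_cast hd
    simp only [add_sub_add_right_eq_sub]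
    simpa [intervalDist] using hd'
  · refine (hlen _ _ (hp x fun h => ?_)).trans (le_max_left _ _)
    obtain ⟨y, hy⟩ := hMp x h
    exact hx y hy
  · refine (hlen _ _ (hq y fun h => ?_)).trans (le_max_right _ _)
    obtain ⟨x, hx⟩ := hMq y h
    exact hy x hx

end NMod

end ReflectionDistance

theorem theorem1 {F : Type u} [Field F] (n : ℕ) (V W : NMod F n) :
    Bottleneck.dist 1 V.diagram W.diagram ≤ NMod.reflectionDistance 1 V W := by
  obtain ⟨R, hR⟩ := NMod.exists_applySeq_precsim V W
  obtain ⟨R', hR'⟩ := NMod.exists_applySeq_precsim W V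
  refine le_csInf ⟨_, R, R', hR, hR', rfl⟩ ?_
  rintro c ⟨R, R', h, h', rfl⟩
  exact NMod.dist_le_of_precsim h h'
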